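/- Let $\alpha>2$, $\beta>0$, and $\ell(d)=(1+d^{\alpha})^{-1}$ for $d\ge 0$. A source at $x_s\in\mathbb R^2$, a relay at $x_r\in\mathbb R^2$ (both arbitrary but fixed) and a destination at the origin are interfered by nodes located at the points $\mathsf x_0,\mathsf x_1,\dots$ of a stationary Poisson point process of density $\lambda>0$ on $\mathbb R^2$. Let $\mathsf u_{sr},\mathsf u_{sd},\mathsf u_{rd}$ (gains of the desired links) and $\mathsf g_i,\mathsf h_i$, $i\ge 0$ (gains from interferer $i$ to the relay and to the destination) be i.i.d. exponential random variables (Rayleigh fading), independent of the interferer locations, with a common mean that does not depend on $\lambda$. Put $\mathsf I_r=\sum_i \mathsf g_i\,\ell(|\mathsf x_i-x_r|)$, $\mathsf I_d=\sum_i \mathsf h_i\,\ell(|\mathsf x_i|)$ and $$\mathsf{SIR}_{sr}=\frac{\mathsf u_{sr}\ell(|x_s-x_r|)}{\mathsf I_r},\qquad \mathsf{SIR}_{srd}=\frac{\mathsf u_{sd}\ell(|x_s|)+\mathsf u_{rd}\ell(|x_r|)}{\mathsf I_d},\qquad \mathsf{SIR}_{sd}=\frac{2\,\mathsf u_{sd}\ell(|x_s|)}{\mathsf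 I_d}.$$ In selection decode-and-forward the SIR at the destination is $\mathsf{SIR}=\mathsf{SIR}_{srd}$ if $\mathsf{SIR}_{sr}\ge\beta$, and $\mathsf{SIR}=\mathsf{SIR}_{sd}$ otherwise. The outage probability is $q=\mathbb P(\mathsf{SIR}<\beta)=q_{BC}+q_{MAC}$ with $q_{BC}=\mathbb P(\mathsf{SIR}_{sd}<\beta,\ \mathsf{SIR}_{sr}<\beta)$ and $q_{MAC}=\mathbb P(\mathsf{SIR}_{srd}<\beta,\ \mathsf{SIR}_{sr}\ge\beta)$. Then the spatial-contention diversity order equals one: $$\Delta=\lim_{\lambda\to0^+}\frac{\log q}{\log\lambda}=1 .$$ Moreover both parts of $q$ scale linearly in $\lambda$: $\lim_{\lambda\to0^+}q_{BC}/\lambda=c_{BC}$ and $\lim_{\lambda\to0^+}q_{MAC}/\lambda=c_{MAC}$ exist with $0<c_{BC}<\infty$ and $0<c_{MAC}<\infty$. Here, with $$\Psi(f,g)=\int_0^\infty\!\int_0^\pi 2r\Big(1-\frac{1}{(1+f(r,\varphi))(1+g(r))}\Big)\,d\varphi\,dr,$$ $$\ell^*_{sd}(r)=\frac{1+|x_s|^\alpha}{1+r^\alpha},\qquad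 \ell^*_{rd}(r)=\frac{1+|x_r|^\alpha}{1+r^\alpha},\qquad \ell^*_{sr}(r,\varphi)=\frac{1+|x_s-x_r|^\alpha}{1+(r^2+|x_r|^2-2r|x_r|\cos\varphi)^{\alpha/2}},$$ one has $$c_{BC}=\Psi\big(0,\tfrac{\beta}{2}\ell^*_{sd}\big)+\Psi\big(\beta\ell^*_{sr},0\big)-\Psi\big(\beta\ell^*_{sr},\tfrac{\beta}{2}\ell^*_{sd}\big),$$ and, if $|x_s|\ne|x_r|$, with $\mu_1=\frac{\ell(|x_s|)}{\ell(|x_s|)-\ell(|x_r|)}$ and $\mu_2=\frac{\ell(|x_r|)}{\ell(|x_s|)-\ell(|x_r|)}$, $$c_{MAC}=-\Psi\big(\beta\ell^*_{sr},0\big)+\mu_1\Psi\big(\beta\ell^*_{sr},\beta\ell^*_{sd}\big)-\mu_2\Psi\big(\beta\ell^*_{sr},\beta\ell^*_{rd}\big).$$ -/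

import Mathlib

open MeasureTheory ProbabilityTheory Filter Topology
open scoped ENNReal

noncomputable section

/-- The Euclidean plane. -/
abbrev Plane : Type := EuclideanSpace ℝ (Fin 2)

/-- Non-singular path loss `ℓ(d) = (1 + d ^ α)⁻¹` at distance `d ≥ 0`. -/
def pathLoss (α d : ℝ) : ℝ := (1 + d ^ α)⁻¹

/-- Number of indices `i` with `X i ω ∈ A`, with value `∞` if there are infinitely many. -/
def pointCount {Ω : Type*} (X : ℕ → Ω → Plane) (A : Set Plane) (ω : Ω) : ℝ≥0∞ :=
  ∑' i, A.indicator (fun _ => (1 : ℝ≥0∞)) (X i ω)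

/-- The random points `X 0, X 1, …` form a stationary Poisson point process of density `lam` on the
plane: counts of Borel sets of finite area are Poisson distributed with mean `lam * area`, and
counts of finitely many pairwise disjoint sets are independent. -/
structure IsStationaryPPP {Ω : Type*} [MeasurableSpace Ω] (P : Measure Ω) (lam : ℝ)
    (X : ℕ → Ω → Plane) : Prop where
  measurable : ∀ i, Measurable (X i)
  count_law : ∀ A : Set Plane, MeasurableSet A → volume A ≠ ∞ → ∀ k : ℕ,
    P.real {ω | pointCount X A ω = k} =
      Real.exp (-(lam * volume.real A)) * (lam * volume.real A) ^ k / (k.factorial : ℝ)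
  count_indep : ∀ (n : ℕ) (A : Fin n → Set Plane), (∀ j, MeasurableSet (A j)) →
    (∀ j, volume (A j) ≠ ∞) → Pairwise (fun j k => Disjoint (A j) (A k)) →
    iIndepFun (fun j => pointCount X (A j)) P

/-- The random quantities of the network: interferer locations `x i`, fading gains `g i` and `h i`
from interferer `i` to the relay and to the destination, and fading gains on the source-relay,
source-destination and relay-destination links. -/
structure Network (Ω : Type*) where
  x : ℕ → Ω → Plane
  g : ℕ → Ω → ℝ
  h : ℕ → Ω → ℝ
  usr : Ω → ℝ
  usd : Ω → ℝ
  urd : Ω → ℝ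

namespace Network

variable {Ω : Type*} (N : Network Ω)

/-- All fading gains as one family: the three desired links, then the `g i`, then the `h i`. -/
def fading : Fin 3 ⊕ ℕ ⊕ ℕ → Ω → ℝ :=
  Sum.elim ![N.usr, N.usd, N.urd] (Sum.elim N.g N.h)

/-- Poisson interferers of density `lam`, with Rayleigh fading on all links: all fading (power)
gains are i.i.d. exponential with rate `κ`, and independent of the interferer locations. -/
structure IsRayleighPoisson [MeasurableSpace Ω] (P : Measure Ω) (lam κ : ℝ) : Prop where
  ppp : IsStationaryPPP P lam N.x
  measurable_fading : ∀ k, Measurable (N.fading k)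
  fading_law : ∀ k, P.map (N.fading k) = expMeasure κ
  fading_indep : iIndepFun N.fading P
  fading_indep_locations : IndepFun (fun ω i => N.x i ω) (fun ω k => N.fading k ω) P

/-- Interference at the relay. Interferences and SIRs are computed in `[0, ∞]`. -/
def interferenceRelay (α : ℝ) (xr : Plane) (ω : Ω) : ℝ≥0∞ :=
  ∑' i, ENNReal.ofReal (N.g i ω * pathLoss α ‖N.x i ω - xr‖)

/-- Interference at the destination, which is located at the origin. -/
def interferenceDest (α : ℝ) (ω : Ω) : ℝ≥0∞ :=
  ∑' i, ENNReal.ofReal (N.h i ω * pathLoss α ‖N.x i ω‖)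

/-- SIR at the relay. -/
def sirSR (α : ℝ) (xs xr : Plane) (ω : Ω) : ℝ≥0∞ :=
  ENNReal.ofReal (N.usr ω * pathLoss α ‖xs - xr‖) / N.interferenceRelay α xr ω

/-- SIR at the destination after combining, when the relay forwards the packet. -/
def sirSRD (α : ℝ) (xs xr : Plane) (ω : Ω) : ℝ≥0∞ :=
  ENNReal.ofReal (N.usd ω * pathLoss α ‖xs‖ + N.urd ω * pathLoss α ‖xr‖) /
    N.interferenceDest α ω

/-- SIR at the destination after combining, when the source repeats the packet. -/
def sirSD (α : ℝ) (xs : Plane) (ω : Ω) : ℝ≥0∞ :=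
  ENNReal.ofReal (2 * N.usd ω * pathLoss α ‖xs‖) / N.interferenceDest α ω

open Classical in
/-- SIR at the destination under selection decode-and-forward: the relay forwards the packet if it
decoded it (its SIR is at least `β`), and otherwise the source repeats it. -/
def sirSDF (α β : ℝ) (xs xr : Plane) (ω : Ω) : ℝ≥0∞ :=
  if ENNReal.ofReal β ≤ N.sirSR α xs xr ω then N.sirSRD α xs xr ω else N.sirSD α xs ω

variable [MeasurableSpace Ω] (P : Measure Ω)

/-- Outage probability `q` of selection decode-and-forward. -/
def outage (α β : ℝ) (xs xr : Plane) : ℝ :=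
  P.real {ω | N.sirSDF α β xs xr ω < ENNReal.ofReal β}

/-- Broadcast-phase part `q_BC` of the outage probability. -/
def outageBC (α β : ℝ) (xs xr : Plane) : ℝ :=
  P.real {ω | N.sirSD α xs ω < ENNReal.ofReal β ∧ N.sirSR α xs xr ω < ENNReal.ofReal β}

/-- MAC-phase part `q_MAC` of the outage probability. -/
def outageMAC (α β : ℝ) (xs xr : Plane) : ℝ :=
  P.real {ω | N.sirSRD α xs xr ω < ENNReal.ofReal β ∧ ENNReal.ofReal β ≤ N.sirSR α xs xr ω}

end Network

/-- `Ψ(f, g) = ∫₀^∞ ∫₀^π 2 r (1 - 1 / ((1 + f(r, φ)) (1 + g(r)))) dφ dr`. -/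
def Psi (f : ℝ → ℝ → ℝ) (g : ℝ → ℝ) : ℝ :=
  ∫ r in Set.Ioi (0 : ℝ), ∫ φ in (0 : ℝ)..Real.pi,
    2 * r * (1 - 1 / ((1 + f r φ) * (1 + g r)))

/-- `ℓ*_sd(r)` for `a = xs` and `ℓ*_rd(r)` for `a = xr`. -/
def relLoss (α : ℝ) (a : Plane) (r : ℝ) : ℝ := (1 + ‖a‖ ^ α) / (1 + r ^ α)

/-- `ℓ*_sr(r, φ)`, with the angle `φ` measured from the direction of the relay. -/
def relLossSR (α : ℝ) (xs xr : Plane) (r φ : ℝ) : ℝ :=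
  (1 + ‖xs - xr‖ ^ α) /
    (1 + (r ^ 2 + ‖xr‖ ^ 2 - 2 * r * ‖xr‖ * Real.cos φ) ^ (α / 2))

/-- First-order coefficient in the density of the broadcast-phase outage probability. -/
def coeffBC (α β : ℝ) (xs xr : Plane) : ℝ :=
  Psi (fun _ _ => 0) (fun r => β / 2 * relLoss α xs r)
    + Psi (fun r φ => β * relLossSR α xs xr r φ) (fun _ => 0)
    - Psi (fun r φ => β * relLossSR α xs xr r φ) (fun r => β / 2 * relLoss α xs r)

/-- First-order coefficient in the density of the MAC-phase outage probability, for
`‖xs‖ ≠ ‖xr‖`. -/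
def coeffMAC (α β : ℝ) (xs xr : Plane) : ℝ :=
  let μ₁ := pathLoss α ‖xs‖ / (pathLoss α ‖xs‖ - pathLoss α ‖xr‖)
  let μ₂ := pathLoss α ‖xr‖ / (pathLoss α ‖xs‖ - pathLoss α ‖xr‖)
  μ₁ * Psi (fun r φ => β * relLossSR α xs xr r φ) (fun r => β * relLoss α xs r)
    - μ₂ * Psi (fun r φ => β * relLossSR α xs xr r φ) (fun r => β * relLoss α xr r)
    - Psi (fun r φ => β * relLossSR α xs xr r φ) (fun _ => 0)

end

/-! Given the two interferences, Rayleigh fading turns each link event into an explicit function of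
them: the relay decodes with probability `exp (-κ s I_r)`, and the destination succeeds with
probability `exp (-κ t I_d)` or with the tail `sumTail` of a weighted sum of two exponentials. So
`q_BC` and `q_MAC` are expectations of products of such functions (`outageBC_eq_integral`,
`outageMAC_eq_integral`).

The relay and the destination see the same interferers, so `I_r` and `I_d` are dependent, but the
Laplace functional of the Poisson process gives their joint transform `E exp (-κ (s I_r + t I_d)) =
exp (-λ L(s, t))`, with `L = laplaceExponent` free of `λ` (`integral_expNeg_interference`). It is
finite because `α > 2` makes the path loss integrable on the plane. Hence the outage probabilities
are explicit combinations of `exp (-λ L)`, and their slopes at `λ = 0` are the matching combinations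
of `L`. In polar coordinates `L` is `Psi` (`Psi_eq_laplaceExponent`). If source and relay have equal
path loss, the tail is `(1 + y) exp (-y)` and its linear factor produces a derivative of `L` in `t`.

Each slope is positive because its integrands combine into a single pointwise positive function.
Finally `log q / log λ = 1 + log (q / λ) / log λ`, where the last numerator stays bounded.

Almost sure finiteness of the interferences is never needed: everything is computed in `[0, ∞]`,
with `exp (-∞) = 0`. -/

/-! ### Negative exponential on `[0, ∞]`. -/

/-- The function `x ↦ exp (-x)` on `[0, ∞]`, with value `0` at `∞`. -/
noncomputable def expNeg (x : ℝ≥0∞) : ℝ := (EReal.exp (-(x : EReal))).toReal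

lemma expNeg_ofReal {r : ℝ} (hr : 0 ≤ r) : expNeg (ENNReal.ofReal r) = Real.exp (-r) := by
  rw [expNeg, EReal.coe_ennreal_ofReal, max_eq_left hr, ← EReal.coe_neg, EReal.exp_coe,
    ENNReal.toReal_ofReal (Real.exp_pos _).le]

lemma expNeg_of_ne_top {x : ℝ≥0∞} (hx : x ≠ ∞) : expNeg x = Real.exp (-x.toReal) := by
  rw [← expNeg_ofReal ENNReal.toReal_nonneg, ENNReal.ofReal_toReal hx]

@[simp] lemma expNeg_top : expNeg ∞ = 0 := by simp [expNeg]

@[simp] lemma expNeg_zero : expNeg 0 = 1 := by simp [expNeg]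

lemma expNeg_nonneg (x : ℝ≥0∞) : 0 ≤ expNeg x := ENNReal.toReal_nonneg

lemma expNeg_le_one (x : ℝ≥0∞) : expNeg x ≤ 1 := by
  by_cases hx : x = ∞
  · simp [hx]
  · rw [expNeg_of_ne_top hx]
    simp

lemma expNeg_add (x y : ℝ≥0∞) : expNeg (x + y) = expNeg x * expNeg y := by
  by_cases hx : x = ∞
  · simp [hx]
  by_cases hy : y = ∞
  · simp [hy]
  rw [expNeg_of_ne_top hx, expNeg_of_ne_top hy, expNeg_of_ne_top (by simp [hx, hy]),
    ENNReal.toReal_add hx hy, ← Real.exp_add]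
  congr 1
  ring

lemma expNeg_sum {ι : Type*} (s : Finset ι) (f : ι → ℝ≥0∞) :
    expNeg (∑ i ∈ s, f i) = ∏ i ∈ s, expNeg (f i) := by
  classical
  induction s using Finset.induction_on with
  | empty => simp
  | insert a s ha ih => rw [Finset.sum_insert ha, Finset.prod_insert ha, expNeg_add, ih]

lemma expNeg_natCast_mul (k : ℕ) (c : ℝ≥0∞) : expNeg (k * c) = expNeg c ^ k := by
  have := expNeg_sum (Finset.range k) (fun _ => c)
  simpa using this

lemma expNeg_antitone : Antitone expNeg := by
  intro x y hxy
  obtain ⟨z, rfl⟩ := exists_add_of_le hxy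
  rw [expNeg_add]
  exact mul_le_of_le_one_right (expNeg_nonneg _) (expNeg_le_one _)

lemma continuous_expNeg : Continuous expNeg := by
  have h : ∀ x : ℝ≥0∞, EReal.exp (-(x : EReal)) ≠ ∞ := by simp
  have hc : Continuous fun x : ℝ≥0∞ => EReal.exp (-(x : EReal)) :=
    ENNReal.continuous_exp.comp (continuous_neg.comp continuous_coe_ennreal_ereal)
  exact continuous_iff_continuousAt.2 fun x =>
    (ENNReal.tendsto_toReal (h x)).comp hc.continuousAt

@[fun_prop] lemma measurable_expNeg : Measurable expNeg := continuous_expNeg.measurable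

lemma integrable_expNeg_comp {Ω : Type*} [MeasurableSpace Ω] {P : Measure Ω} [IsFiniteMeasure P]
    {f : Ω → ℝ≥0∞} (hf : Measurable f) : Integrable (fun ω => expNeg (f ω)) P :=
  Integrable.of_bound (measurable_expNeg.comp hf).aestronglyMeasurable 1 (.of_forall fun ω => by
    rw [Real.norm_of_nonneg (expNeg_nonneg _)]
    exact expNeg_le_one _)

lemma tendsto_integral_expNeg {Ω : Type*} [MeasurableSpace Ω] {P : Measure Ω} [IsFiniteMeasure P]
    {f : ℕ → Ω → ℝ≥0∞} {g : Ω → ℝ≥0∞} (hf : ∀ n, Measurable (f n))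
    (h : ∀ ω, Tendsto (fun n => f n ω) atTop (𝓝 (g ω))) :
    Tendsto (fun n => ∫ ω, expNeg (f n ω) ∂P) atTop (𝓝 (∫ ω, expNeg (g ω) ∂P)) := by
  refine tendsto_integral_of_dominated_convergence (fun _ => 1)
    (fun n => (measurable_expNeg.comp (hf n)).aestronglyMeasurable) (integrable_const _)
    (fun n => .of_forall fun ω => ?_)
    (.of_forall fun ω => (continuous_expNeg.tendsto _).comp (h ω))
  rw [Real.norm_of_nonneg (expNeg_nonneg _)]
  exact expNeg_le_one _

/-! ### Laplace functional of a Poisson process -/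

/-- The Poisson weights sum to one, so the disjoint events `M = k` exhaust the space up to a null
set; integrality and finiteness of `M` need no separate argument. Summing `expNeg c ^ k` against the
weights is then an exponential series, also for `c = ∞`. -/
lemma integral_expNeg_mul_of_poisson {Ω : Type*} [MeasurableSpace Ω] {P : Measure Ω}
    [IsProbabilityMeasure P] {M : Ω → ℝ≥0∞} (hM : Measurable M) {m : ℝ}
    (hP : ∀ k : ℕ, P.real {ω | M ω = k} = Real.exp (-m) * m ^ k / (k.factorial : ℝ))
    (c : ℝ≥0∞) :
    ∫ ω, expNeg (c * M ω) ∂P = Real.exp (-(m * (1 - expNeg c))) := by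
  have hms : ∀ k : ℕ, MeasurableSet {ω | M ω = k} := fun k => hM (measurableSet_singleton _)
  have hdisj : Pairwise (Function.onFun Disjoint fun k : ℕ => {ω | M ω = k}) := by
    intro i j hij
    refine Set.disjoint_left.2 fun ω hi hj => hij ?_
    have : (i : ℝ≥0∞) = j := (show M ω = i from hi).symm.trans hj
    exact_mod_cast this
  have hexp : ∀ x : ℝ, HasSum (fun k : ℕ => Real.exp (-m) * (m * x) ^ k / (k.factorial : ℝ))
      (Real.exp (-m) * Real.exp (m * x)) := by
    intro x
    have := (NormedSpace.expSeries_div_hasSum_exp (m * x)).mul_left (Real.exp (-m))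
    rw [← Real.exp_eq_exp_ℝ] at this
    simpa [mul_div_assoc] using this
  have huniv : P (⋃ k : ℕ, {ω | M ω = k}) = 1 := by
    rw [measure_iUnion hdisj hms]
    have h1 : HasSum (fun k : ℕ => P.real {ω | M ω = k}) 1 := by
      have := hexp 1
      simp only [mul_one, ← Real.exp_add, neg_add_cancel, Real.exp_zero] at this
      simpa [hP] using this
    have h2 := ENNReal.ofReal_tsum_of_nonneg (fun k => measureReal_nonneg) h1.summable
    rw [h1.tsum_eq] at h2
    simpa using h2.symm
  have hae : (⋃ k : ℕ, {ω | M ω = k}) =ᵐ[P] Set.univ := by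
    rw [ae_eq_univ, prob_compl_eq_zero_iff (MeasurableSet.iUnion hms)]
    exact huniv
  have hint : Integrable (fun ω => expNeg (c * M ω)) P := integrable_expNeg_comp (by fun_prop)
  have hsum := hasSum_integral_iUnion hms hdisj hint.integrableOn
  rw [setIntegral_congr_set hae, setIntegral_univ] at hsum
  have hterm : ∀ k : ℕ, ∫ ω in {ω | M ω = k}, expNeg (c * M ω) ∂P =
      Real.exp (-m) * (m * expNeg c) ^ k / (k.factorial : ℝ) := by
    intro k
    rw [setIntegral_congr_fun (g := fun _ => expNeg c ^ k) (hms k)]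
    · rw [setIntegral_const, hP, smul_eq_mul]
      ring
    · intro ω hω
      have hω' : M ω = k := hω
      simp only [hω']
      rw [mul_comm, expNeg_natCast_mul]
  simp_rw [hterm] at hsum
  rw [hsum.unique (hexp (expNeg c)), ← Real.exp_add]
  congr 1
  ring

lemma measurable_pointCount {Ω : Type*} [MeasurableSpace Ω] {X : ℕ → Ω → Plane}
    (hX : ∀ i, Measurable (X i)) {A : Set Plane} (hA : MeasurableSet A) :
    Measurable (pointCount X A) := by
  unfold pointCount
  exact Measurable.tsum fun i => (measurable_const.indicator hA).comp (hX i)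

namespace IsStationaryPPP

variable {Ω : Type*} [MeasurableSpace Ω] {P : Measure Ω} [IsProbabilityMeasure P] {lam : ℝ}
  {X : ℕ → Ω → Plane}

/-- For a simple weight the sum over the points is a finite combination of counts of disjoint level
sets, which are independent and Poisson, so the expectation factorizes. -/
lemma integral_expNeg_tsum_simpleFunc (h : IsStationaryPPP P lam X) (hlam : 0 ≤ lam)
    (w : SimpleFunc Plane ℝ≥0∞) (hw : ∀ y ≠ 0, volume (w ⁻¹' {y}) ≠ ∞) :
    ∫ ω, expNeg (∑' i, w (X i ω)) ∂P =
      expNeg (ENNReal.ofReal lam * ∫⁻ x, ENNReal.ofReal (1 - expNeg (w x))) := by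
  classical
  -- The level set of `0` may have infinite area, but it contributes nothing to the sum and is
  -- dropped.
  set s := w.range.filter (· ≠ 0) with hs
  have hwx : ∀ x, w x = ∑ y ∈ s, y * (w ⁻¹' {y}).indicator (fun _ => (1 : ℝ≥0∞)) x := by
    intro x
    by_cases hx : w x = 0
    · rw [hx]
      symm
      refine Finset.sum_eq_zero fun y hy => ?_
      have : w x ≠ y := by
        rw [hx]
        exact (Finset.mem_filter.1 hy).2.symm
      simp [this]
    · rw [Finset.sum_eq_single (w x)]
      · simp
      · intro y _ hyx
        simp [hyx.symm]
      · intro hn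
        exact absurd (Finset.mem_filter.2 ⟨w.mem_range_self x, hx⟩) hn
  have hcount : ∀ ω, ∑' i, w (X i ω) = ∑ y ∈ s, y * pointCount X (w ⁻¹' {y}) ω := by
    intro ω
    simp_rw [pointCount, ← ENNReal.tsum_mul_left]
    rw [← Summable.tsum_finsetSum fun _ _ => ENNReal.summable]
    exact tsum_congr fun i => hwx _
  have hmeas : ∀ y, MeasurableSet (w ⁻¹' {y}) := fun y => w.measurableSet_fiber y
  have hindep : iIndepFun (fun y : s => pointCount X (w ⁻¹' {(y : ℝ≥0∞)})) P := by
    have := h.count_indep s.card (fun j => w ⁻¹' {((s.equivFin.symm j : s) : ℝ≥0∞)})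
      (fun j => hmeas _)
      (fun j => hw _ (Finset.mem_filter.1 (s.equivFin.symm j).2).2) (by
        intro j k hjk
        refine (Set.disjoint_singleton.2 fun he => hjk ?_).preimage _
        exact s.equivFin.symm.injective (Subtype.ext he))
    have h2 := this.precomp (g := s.equivFin) s.equivFin.injective
    simpa using h2
  have hprod : ∫ ω, expNeg (∑' i, w (X i ω)) ∂P =
      ∏ y : s, ∫ ω, expNeg ((y : ℝ≥0∞) * pointCount X (w ⁻¹' {(y : ℝ≥0∞)}) ω) ∂P := by
    rw [← iIndepFun.integral_fun_prod_comp (f := fun (y : s) z => expNeg ((y : ℝ≥0∞) * z)) hindep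
      (fun y => (measurable_pointCount h.measurable (hmeas _)).aemeasurable)
      (fun y => by
        exact (measurable_expNeg.comp (measurable_const_mul _)).aestronglyMeasurable)]
    congr 1
    ext ω
    rw [hcount, expNeg_sum, ← Finset.prod_coe_sort]
  have hint : ∫⁻ x, ENNReal.ofReal (1 - expNeg (w x)) =
      ∑ y ∈ s, ENNReal.ofReal (1 - expNeg y) * volume (w ⁻¹' {y}) := by
    have : ∀ x, ENNReal.ofReal (1 - expNeg (w x)) = (w.map fun y => ENNReal.ofReal (1 - expNeg y)) x :=
      fun x => rfl
    simp_rw [this]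
    rw [SimpleFunc.lintegral_eq_lintegral, SimpleFunc.map_lintegral, hs, Finset.sum_filter]
    refine Finset.sum_congr rfl fun y _ => ?_
    split_ifs with hy
    · rfl
    · simp only [ne_eq, not_not] at hy
      simp [hy]
  rw [hprod, hint, Finset.mul_sum, expNeg_sum, ← Finset.prod_coe_sort s]
  refine Finset.prod_congr rfl fun y _ => ?_
  have hv := hw y (Finset.mem_filter.1 y.2).2
  rw [integral_expNeg_mul_of_poisson (measurable_pointCount h.measurable (hmeas _))
    (h.count_law _ (hmeas _) hv), ← ENNReal.ofReal_toReal hv,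
    ← ENNReal.ofReal_mul (sub_nonneg.2 (expNeg_le_one _)), ← ENNReal.ofReal_mul hlam, expNeg_ofReal]
  · rw [measureReal_def]
    congr 1
    ring
  · have := sub_nonneg.2 (expNeg_le_one y)
    positivity

/-- Laplace functional of a stationary Poisson point process. -/
theorem integral_expNeg_tsum (h : IsStationaryPPP P lam X) (hlam : 0 ≤ lam)
    {w : Plane → ℝ≥0∞} (hw : Measurable w) :
    ∫ ω, expNeg (∑' i, w (X i ω)) ∂P =
      expNeg (ENNReal.ofReal lam * ∫⁻ x, ENNReal.ofReal (1 - expNeg (w x))) := by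
  -- Cutting off to balls gives the nonzero values level sets of finite area and keeps the
  -- approximation monotone.
  let φ : ℕ → SimpleFunc Plane ℝ≥0∞ := fun n =>
    (SimpleFunc.eapprox w n).restrict (Metric.closedBall 0 n)
  have hφ : ∀ n x, φ n x =
      (Metric.closedBall (0 : Plane) n).indicator (SimpleFunc.eapprox w n) x := fun n x => by
    rw [SimpleFunc.restrict_apply _ Metric.isClosed_closedBall.measurableSet]
  have hmono : ∀ x, Monotone fun n => φ n x := by
    intro x m n hmn
    simp only [hφ]
    refine (Set.indicator_le_indicator (SimpleFunc.monotone_eapprox w hmn x)).trans ?_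
    refine Set.indicator_le_indicator_of_subset ?_ (fun _ => zero_le) x
    exact Metric.closedBall_subset_closedBall (by exact_mod_cast hmn)
  have hlim : ∀ x, Tendsto (fun n => φ n x) atTop (𝓝 (w x)) := by
    intro x
    refine (SimpleFunc.tendsto_eapprox hw x).congr' ?_
    obtain ⟨n₀, hn₀⟩ := exists_nat_ge ‖x‖
    filter_upwards [eventually_ge_atTop n₀] with n hn
    rw [hφ, Set.indicator_of_mem]
    rw [mem_closedBall_zero_iff]
    exact hn₀.trans (by exact_mod_cast hn)
  have hfin : ∀ n, ∀ y ≠ 0, volume (φ n ⁻¹' {y}) ≠ ∞ := by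
    intro n y hy
    refine ((measure_mono ?_).trans_lt
      (isCompact_closedBall (0 : Plane) (n : ℝ)).measure_lt_top).ne
    intro x hx
    by_contra hxn
    simp only [Set.mem_preimage, Set.mem_singleton_iff, hφ, Set.indicator_of_notMem hxn] at hx
    exact hy hx.symm
  have hL : Tendsto (fun n => ∫ ω, expNeg (∑' i, φ n (X i ω)) ∂P) atTop
      (𝓝 (∫ ω, expNeg (∑' i, w (X i ω)) ∂P)) := by
    refine tendsto_integral_expNeg
      (fun n => Measurable.tsum fun i => (φ n).measurable.comp (h.measurable i))
      fun ω => ?_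
    -- The sum over indices is an integral against counting measure, so monotone convergence
    -- applies.
    simp_rw [← lintegral_count]
    exact lintegral_tendsto_of_tendsto_of_monotone
      (fun n => (measurable_of_countable _).aemeasurable)
      (.of_forall fun i => hmono _) (.of_forall fun i => hlim _)
  have hR : Tendsto (fun n => ∫⁻ x, ENNReal.ofReal (1 - expNeg (φ n x))) atTop
      (𝓝 (∫⁻ x, ENNReal.ofReal (1 - expNeg (w x)))) := by
    refine lintegral_tendsto_of_tendsto_of_monotone
      (fun n => ?_) (.of_forall fun x m n hmn => ?_) (.of_forall fun x => ?_)
    · exact (measurable_const.sub (measurable_expNeg.comp (φ n).measurable)).ennreal_ofReal.aemeasurable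
    · exact ENNReal.ofReal_le_ofReal (sub_le_sub_left (expNeg_antitone (hmono x hmn)) _)
    · exact (ENNReal.continuous_ofReal.tendsto _).comp
        (((continuous_expNeg.tendsto _).comp (hlim x)).const_sub 1)
  simp_rw [h.integral_expNeg_tsum_simpleFunc hlam _ (hfin _)] at hL
  refine tendsto_nhds_unique hL ((continuous_expNeg.tendsto _).comp ?_)
  exact ENNReal.Tendsto.const_mul hR (.inr ENNReal.ofReal_ne_top)

end IsStationaryPPP

/-! ### Independence -/

section Independence

variable {Ω : Type*} [MeasurableSpace Ω] {P : Measure Ω}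

lemma ProbabilityTheory.IndepFun.integral_comp_prodMk [IsProbabilityMeasure P] {E F : Type*}
    [MeasurableSpace E] [MeasurableSpace F] {f : Ω → E} {g : Ω → F} (h : IndepFun f g P)
    (hf : Measurable f) (hg : Measurable g) {Φ : E × F → ℝ} (hΦ : Measurable Φ) {C : ℝ}
    (hC : ∀ z, ‖Φ z‖ ≤ C) :
    ∫ ω, Φ (f ω, g ω) ∂P = ∫ ω₁, ∫ ω₂, Φ (f ω₁, g ω₂) ∂P ∂P := by
  have := Measure.isProbabilityMeasure_map (μ := P) hf.aemeasurable
  have := Measure.isProbabilityMeasure_map (μ := P) hg.aemeasurable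
  rw [← integral_map (f := Φ) (hf.prodMk hg).aemeasurable hΦ.aestronglyMeasurable,
    (indepFun_iff_map_prod_eq_prod_map_map hf.aemeasurable hg.aemeasurable).1 h,
    integral_prod _ (Integrable.of_bound hΦ.aestronglyMeasurable C (.of_forall hC)),
    integral_map hf.aemeasurable]
  · congr 1
    ext ω
    rw [integral_map hg.aemeasurable]
    exact (hΦ.comp measurable_prodMk_left).aestronglyMeasurable
  · exact (StronglyMeasurable.integral_prod_right (f := fun x y => Φ (x, y))
      hΦ.stronglyMeasurable).aestronglyMeasurable

/-- The law of the triple is a product of three measures, and products of measures are associative.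
-/
lemma ProbabilityTheory.IndepFun.prodMk_left_of_prodMk_right [IsProbabilityMeasure P]
    {E F G : Type*} [MeasurableSpace E] [MeasurableSpace F] [MeasurableSpace G]
    {X : Ω → E} {Y : Ω → F} {Z : Ω → G} (hX : Measurable X) (hY : Measurable Y)
    (hZ : Measurable Z) (h : IndepFun X (fun ω => (Y ω, Z ω)) P) (hYZ : IndepFun Y Z P) :
    IndepFun (fun ω => (X ω, Y ω)) Z P := by
  have hXY : IndepFun X Y P := h.comp measurable_id measurable_fst
  rw [indepFun_iff_map_prod_eq_prod_map_map hX.aemeasurable (hY.prodMk hZ).aemeasurable,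
    (indepFun_iff_map_prod_eq_prod_map_map hY.aemeasurable hZ.aemeasurable).1 hYZ] at h
  rw [indepFun_iff_map_prod_eq_prod_map_map (hX.prodMk hY).aemeasurable hZ.aemeasurable,
    (indepFun_iff_map_prod_eq_prod_map_map hX.aemeasurable hY.aemeasurable).1 hXY]
  have := Measure.isProbabilityMeasure_map (μ := P) hX.aemeasurable
  have := Measure.isProbabilityMeasure_map (μ := P) hY.aemeasurable
  have := Measure.isProbabilityMeasure_map (μ := P) hZ.aemeasurable
  apply (MeasurableEquiv.prodAssoc (α := E) (β := F) (γ := G)).map_measurableEquiv_injective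
  rw [Measure.prodAssoc_prod, ← h,
    Measure.map_map MeasurableEquiv.prodAssoc.measurable ((hX.prodMk hY).prodMk hZ)]
  rfl

/-- The two subfamilies generate σ-algebras over disjoint index sets. This separates the desired
links from the interferers' gains. -/
lemma ProbabilityTheory.iIndepFun.indepFun_inl_inr {ι κ : Type*} {E : Type*}
    [mE : MeasurableSpace E] {Y : ι ⊕ κ → Ω → E} (h : iIndepFun Y P) (hY : ∀ k, Measurable (Y k)) :
    IndepFun (fun ω i => Y (.inl i) ω) (fun ω k => Y (.inr k) ω) P := by
  have hd : Disjoint (Set.range (Sum.inl : ι → ι ⊕ κ)) (Set.range (Sum.inr : κ → ι ⊕ κ)) :=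
    Set.isCompl_range_inl_range_inr.disjoint
  have hI := indep_iSup_of_disjoint (m := fun k => mE.comap (Y k))
    (fun k => (hY k).comap_le) h.iIndep hd
  refine indep_of_indep_of_le_left (indep_of_indep_of_le_right hI ?_) ?_
  · refine Measurable.comap_le ?_
    refine @measurable_pi_lambda _ _ _ (_) _ _ fun k => ?_
    exact Measurable.mono (comap_measurable (Y (.inr k)))
      (le_iSup₂_of_le (f := fun j (_ : j ∈ Set.range Sum.inr) => mE.comap (Y j))
        (Sum.inr k) (Set.mem_range_self k) le_rfl) le_rfl
  · refine Measurable.comap_le ?_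
    refine @measurable_pi_lambda _ _ _ (_) _ _ fun k => ?_
    exact Measurable.mono (comap_measurable (Y (.inl k)))
      (le_iSup₂_of_le (f := fun j (_ : j ∈ Set.range Sum.inl) => mE.comap (Y j))
        (Sum.inl k) (Set.mem_range_self k) le_rfl) le_rfl

end Independence

/-! ### Exponential variables -/

lemma integral_expMeasure {r : ℝ} (hr : 0 < r) (F : ℝ → ℝ) :
    ∫ x, F x ∂expMeasure r = ∫ x in Set.Ioi 0, r * Real.exp (-(r * x)) * F x := by
  have : expMeasure r = volume.withDensity (exponentialPDF r) := rfl
  rw [this, integral_withDensity_eq_integral_toReal_smul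
      (f := exponentialPDF r) (measurable_exponentialPDFReal r).ennreal_ofReal (.of_forall fun x => ENNReal.ofReal_lt_top),
    ← integral_Ici_eq_integral_Ioi, ← integral_indicator measurableSet_Ici]
  congr 1
  ext x
  by_cases hx : 0 ≤ x
  · rw [Set.indicator_of_mem (Set.mem_Ici.2 hx), exponentialPDF_of_nonneg hx,
      ENNReal.toReal_ofReal (by positivity), smul_eq_mul]
  · rw [Set.indicator_of_notMem (by simpa using hx), exponentialPDF_of_neg (not_le.1 hx)]
    simp

lemma integral_Ioi_exp_neg_mul {a : ℝ} (ha : 0 < a) (c : ℝ) :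
    ∫ x in Set.Ioi c, Real.exp (-(a * x)) = Real.exp (-(a * c)) / a := by
  have := integral_comp_mul_left_Ioi (fun x => Real.exp (-x)) c ha
  rw [this, integral_exp_neg_Ioi, smul_eq_mul]
  ring

section Exponential

variable {Ω : Type*} [MeasurableSpace Ω] {P : Measure Ω} {κ : ℝ}
  {u v : Ω → ℝ}

lemma ae_pos_of_map_eq_expMeasure (hu : Measurable u)
    (hl : P.map u = expMeasure κ) : ∀ᵐ ω ∂P, 0 < u ω := by
  have h : ∀ᵐ x ∂expMeasure κ, 0 < x := by
    rw [ae_iff]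
    have h0 : expMeasure κ = volume.withDensity (exponentialPDF κ) := rfl
    have : {x : ℝ | ¬ 0 < x} = Set.Iic 0 := by
      ext
      simp
    rw [this, h0, withDensity_apply _ measurableSet_Iic, setLIntegral_congr Iio_ae_eq_Iic.symm,
      lintegral_exponentialPDF_of_nonpos le_rfl]
  rw [← hl] at h
  exact ae_of_ae_map hu.aemeasurable h

lemma measureReal_le_of_map_eq_expMeasure (hκ : 0 < κ) (hu : Measurable u)
    (hl : P.map u = expMeasure κ) {y : ℝ} (hy : 0 ≤ y) :
    P.real {ω | y ≤ u ω} = Real.exp (-(κ * y)) := by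
  have hs : {ω | y ≤ u ω} = u ⁻¹' Set.Ici y := rfl
  have h1 : (expMeasure κ).real (Set.Ici y) = ∫ x, (Set.Ici y).indicator 1 x ∂expMeasure κ :=
    (integral_indicator_one measurableSet_Ici).symm
  rw [hs, ← map_measureReal_apply hu measurableSet_Ici, hl, h1, integral_expMeasure hκ]
  have h2 : ∀ x, κ * Real.exp (-(κ * x)) * (Set.Ici y).indicator 1 x =
      (Set.Ici y).indicator (fun x => κ * Real.exp (-(κ * x))) x := by
    intro x
    by_cases hx : x ∈ Set.Ici y <;> simp [hx]
  simp_rw [h2]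
  rw [← integral_Ici_eq_integral_Ioi, setIntegral_indicator measurableSet_Ici,
    Set.inter_eq_self_of_subset_right (Set.Ici_subset_Ici.2 hy), integral_Ici_eq_integral_Ioi,
    integral_const_mul, integral_Ioi_exp_neg_mul hκ]
  field_simp

lemma integral_expNeg_ofReal_mul (hκ : 0 < κ) (hu : Measurable u)
    (hl : P.map u = expMeasure κ) {c : ℝ} (hc : 0 ≤ c) :
    ∫ ω, expNeg (ENNReal.ofReal (u ω * c)) ∂P = (1 + c / κ)⁻¹ := by
  rw [← integral_map (f := fun x => expNeg (ENNReal.ofReal (x * c))) hu.aemeasurable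
    (by
      refine (measurable_expNeg.comp ?_).aestronglyMeasurable
      fun_prop), hl, integral_expMeasure hκ]
  have : Set.EqOn (fun x => κ * Real.exp (-(κ * x)) * expNeg (ENNReal.ofReal (x * c)))
      (fun x => κ * Real.exp (-((κ + c) * x))) (Set.Ioi 0) := by
    intro x hx
    have hx' : 0 < x := hx
    simp only
    rw [expNeg_ofReal (by positivity), mul_assoc, ← Real.exp_add]
    congr 2
    ring
  rw [setIntegral_congr_fun measurableSet_Ioi this, integral_const_mul,
    integral_Ioi_exp_neg_mul (by positivity)]
  simp only [mul_zero, neg_zero, Real.exp_zero]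
  field_simp

/-- Tail of an exponential variable, with threshold in `[0, ∞]`. -/
lemma measureReal_ofReal_mul_le (hκ : 0 < κ) (hu : Measurable u)
    (hl : P.map u = expMeasure κ) {a β : ℝ} (ha : 0 < a) (hβ : 0 < β) (y : ℝ≥0∞) :
    P.real {ω | ENNReal.ofReal β * y ≤ ENNReal.ofReal (u ω * a)} =
      expNeg (ENNReal.ofReal (κ * (β / a)) * y) := by
  -- For an infinite threshold the event is empty and the right side is `expNeg ∞ = 0`.
  by_cases hy : y = ∞
  · subst hy
    rw [ENNReal.mul_top (by simpa using hβ), ENNReal.mul_top (by simp; positivity)]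
    simp
  obtain ⟨y, rfl⟩ : ∃ z : NNReal, y = z := ⟨y.toNNReal, (ENNReal.coe_toNNReal hy).symm⟩
  rw [← ENNReal.ofReal_coe_nnreal, ← ENNReal.ofReal_mul hβ.le, ← ENNReal.ofReal_mul (by positivity),
    expNeg_ofReal (by positivity), mul_assoc,
    ← measureReal_le_of_map_eq_expMeasure hκ hu hl (y := β / a * y) (by positivity)]
  refine measureReal_congr ?_
  filter_upwards [ae_pos_of_map_eq_expMeasure hu hl] with ω hω
  refine propext ?_
  change _ ≤ _ ↔ _ ≤ _
  rw [ENNReal.ofReal_le_ofReal_iff (by positivity), div_mul_eq_mul_div, div_le_iff₀ ha]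

variable [IsProbabilityMeasure P]

/-- The factors `(1 + c i / κ)⁻¹` are written as exponentials of logarithms, so that the infinite
product becomes a sum in `[0, ∞]`, possibly divergent, to which the Laplace functional applies. -/
lemma integral_expNeg_tsum_ofReal_mul (hκ : 0 < κ) {ι : Type*} [Countable ι] {Y : ι → Ω → ℝ}
    (hY : ∀ i, Measurable (Y i)) (hl : ∀ i, P.map (Y i) = expMeasure κ) (hI : iIndepFun Y P)
    {c : ι → ℝ} (hc : ∀ i, 0 ≤ c i) :
    ∫ ω, expNeg (∑' i, ENNReal.ofReal (Y i ω * c i)) ∂P =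
      expNeg (∑' i, ENNReal.ofReal (Real.log (1 + c i / κ))) := by
  have hpos : ∀ i, 1 ≤ 1 + c i / κ := fun i => by
    have := div_nonneg (hc i) hκ.le
    linarith
  have hfin : ∀ s : Finset ι, ∫ ω, expNeg (∑ i ∈ s, ENNReal.ofReal (Y i ω * c i)) ∂P =
      expNeg (∑ i ∈ s, ENNReal.ofReal (Real.log (1 + c i / κ))) := by
    intro s
    have hI' : iIndepFun (fun i : s => Y i) P := hI.precomp Subtype.val_injective
    simp_rw [expNeg_sum]
    rw [← Finset.prod_coe_sort s (fun i => expNeg (ENNReal.ofReal (Real.log (1 + c i / κ))))]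
    simp_rw [← Finset.prod_coe_sort s (fun i => expNeg (ENNReal.ofReal (Y i _ * c i)))]
    rw [iIndepFun.integral_fun_prod_comp
      (f := fun (i : s) z => expNeg (ENNReal.ofReal (z * c i))) hI'
      (fun i => (hY i).aemeasurable) (fun i => by
        refine (measurable_expNeg.comp ?_).aestronglyMeasurable
        fun_prop)]
    refine Finset.prod_congr rfl fun i _ => ?_
    rw [integral_expNeg_ofReal_mul hκ (hY i) (hl i) (hc i),
      expNeg_ofReal (Real.log_nonneg (hpos i)), Real.exp_neg,
      Real.exp_log (by linarith [hpos i])]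
  have h1 : Tendsto (fun s : Finset ι => ∫ ω, expNeg (∑ i ∈ s, ENNReal.ofReal (Y i ω * c i)) ∂P)
      atTop (𝓝 (∫ ω, expNeg (∑' i, ENNReal.ofReal (Y i ω * c i)) ∂P)) := by
    -- Dominated convergence runs along the filter of finite subsets, countably generated because
    -- `ι` is countable.
    refine tendsto_integral_filter_of_dominated_convergence (fun _ => 1)
      (.of_forall fun s => (measurable_expNeg.comp ?_).aestronglyMeasurable)
      (.of_forall fun s => .of_forall fun ω => ?_) (integrable_const _)
      (.of_forall fun ω => (continuous_expNeg.tendsto _).comp ENNReal.summable.hasSum)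
    · exact Finset.measurable_sum _ fun i _ => ((hY i).mul_const _).ennreal_ofReal
    · rw [Real.norm_of_nonneg (expNeg_nonneg _)]
      exact expNeg_le_one _
  simp_rw [hfin] at h1
  exact tendsto_nhds_unique h1 ((continuous_expNeg.tendsto _).comp ENNReal.summable.hasSum)

/-- Conditioning on `u = x` leaves the tail of `v` at `max 0 ((y - x * b) / c)`, and the integral
over `x` is split at `y / b`, where the maximum changes branch. The remaining integral is left
unevaluated because its value differs according to whether `b = c`. -/
lemma measureReal_le_add_of_map_eq_expMeasure (hκ : 0 < κ) (hu : Measurable u) (hv : Measurable v)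
    (hlu : P.map u = expMeasure κ) (hlv : P.map v = expMeasure κ) (huv : IndepFun u v P)
    {b c y : ℝ} (hb : 0 < b) (hc : 0 < c) (hy : 0 ≤ y) :
    P.real {ω | y ≤ u ω * b + v ω * c} = Real.exp (-(κ * (y / b))) +
      κ * Real.exp (-(κ * (y / c))) * ∫ x in (0 : ℝ)..(y / b), Real.exp (κ * (b / c - 1) * x) := by
  have hset : MeasurableSet {z : ℝ × ℝ | y ≤ z.1 * b + z.2 * c} :=
    measurableSet_le measurable_const (by fun_prop)
  have h1 : P.real {ω | y ≤ u ω * b + v ω * c} =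
      ∫ ω, {z : ℝ × ℝ | y ≤ z.1 * b + z.2 * c}.indicator 1 (u ω, v ω) ∂P := by
    rw [← integral_indicator_one (measurableSet_le measurable_const (by fun_prop))]
    rfl
  have hin : ∀ᵐ ω₁ ∂P, ∫ ω₂, {z : ℝ × ℝ | y ≤ z.1 * b + z.2 * c}.indicator
      (1 : ℝ × ℝ → ℝ) (u ω₁, v ω₂) ∂P = Real.exp (-(κ * max 0 ((y - u ω₁ * b) / c))) := by
    refine .of_forall fun ω₁ => ?_
    rw [← measureReal_le_of_map_eq_expMeasure hκ hv hlv (le_max_left _ _)]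
    have : ∀ ω₂, {z : ℝ × ℝ | y ≤ z.1 * b + z.2 * c}.indicator
      (1 : ℝ × ℝ → ℝ) (u ω₁, v ω₂) = {ω | y ≤ u ω₁ * b + v ω * c}.indicator 1 ω₂ := fun _ => rfl
    simp_rw [this]
    rw [integral_indicator_one (measurableSet_le measurable_const (by fun_prop))]
    refine measureReal_congr ?_
    filter_upwards [ae_pos_of_map_eq_expMeasure hv hlv] with ω hω
    refine propext ?_
    change _ ≤ _ ↔ _ ≤ _
    rw [max_le_iff, div_le_iff₀ hc, sub_le_iff_le_add, add_comm]
    simp [hω.le]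
  rw [h1, huv.integral_comp_prodMk hu hv (measurable_one.indicator hset) (C := 1)
    (fun z => by
      refine (norm_indicator_le_norm_self _ _).trans ?_
      simp), integral_congr_ae hin,
    ← integral_map (f := fun x => Real.exp (-(κ * max 0 ((y - x * b) / c)))) hu.aemeasurable
      (by fun_prop), hlu, integral_expMeasure hκ]
  have hyb : 0 ≤ y / b := by positivity
  have hA : Set.EqOn (fun x => κ * Real.exp (-(κ * x)) * Real.exp (-(κ * max 0 ((y - x * b) / c))))
      (fun x => κ * Real.exp (-(κ * (y / c))) * Real.exp (κ * (b / c - 1) * x))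
      (Set.Ioc 0 (y / b)) := by
    intro x hx
    have : x * b ≤ y := (le_div_iff₀ hb).1 hx.2
    simp only
    rw [max_eq_right (div_nonneg (by linarith) hc.le), mul_assoc, mul_assoc, ← Real.exp_add,
      ← Real.exp_add]
    congr 2
    field_simp
    ring
  have hB : Set.EqOn (fun x => κ * Real.exp (-(κ * x)) * Real.exp (-(κ * max 0 ((y - x * b) / c))))
      (fun x => κ * Real.exp (-(κ * x))) (Set.Ioi (y / b)) := by
    intro x hx
    have : y < x * b := (div_lt_iff₀ hb).1 hx
    simp only
    rw [max_eq_left (div_nonpos_of_nonpos_of_nonneg (by linarith) hc.le)]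
    simp
  have hiA : IntegrableOn (fun x => κ * Real.exp (-(κ * x)) *
      Real.exp (-(κ * max 0 ((y - x * b) / c)))) (Set.Ioc 0 (y / b)) := by
    refine Continuous.integrableOn_Ioc ?_
    fun_prop
  have hiB : IntegrableOn (fun x => κ * Real.exp (-(κ * x)) *
      Real.exp (-(κ * max 0 ((y - x * b) / c)))) (Set.Ioi (y / b)) := by
    refine IntegrableOn.congr_fun ?_ hB.symm measurableSet_Ioi
    refine Integrable.const_mul ?_ _
    simpa [IntegrableOn, neg_mul] using exp_neg_integrableOn_Ioi (y / b) hκ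
  rw [← Set.Ioc_union_Ioi_eq_Ioi hyb, setIntegral_union (Set.Ioc_disjoint_Ioi le_rfl)
    measurableSet_Ioi hiA hiB, setIntegral_congr_fun measurableSet_Ioc hA,
    setIntegral_congr_fun measurableSet_Ioi hB, integral_const_mul, integral_const_mul,
    integral_Ioi_exp_neg_mul hκ, ← intervalIntegral.integral_of_le hyb, add_comm]
  congr 1
  field_simp

/-- Tail of a weighted sum of two independent exponential variables, as a function of the
threshold in `[0, ∞]`. -/
noncomputable def sumTail (κ β b c : ℝ) (y : ℝ≥0∞) : ℝ :=
  if b = c then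
    (1 + (ENNReal.ofReal (κ * (β / b)) * y).toReal) * expNeg (ENNReal.ofReal (κ * (β / b)) * y)
  else
    b / (b - c) * expNeg (ENNReal.ofReal (κ * (β / b)) * y)
      - c / (b - c) * expNeg (ENNReal.ofReal (κ * (β / c)) * y)

lemma measureReal_ofReal_mul_add_le (hκ : 0 < κ) (hu : Measurable u) (hv : Measurable v)
    (hlu : P.map u = expMeasure κ) (hlv : P.map v = expMeasure κ) (huv : IndepFun u v P)
    {b c β : ℝ} (hb : 0 < b) (hc : 0 < c) (hβ : 0 < β) (y : ℝ≥0∞) :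
    P.real {ω | ENNReal.ofReal β * y ≤ ENNReal.ofReal (u ω * b + v ω * c)} =
      sumTail κ β b c y := by
  -- In the branch `b = c` the linear factor takes the value `1` here, since `∞.toReal = 0`; the
  -- factor `expNeg ∞ = 0` makes this harmless.
  by_cases hy : y = ∞
  · subst hy
    rw [sumTail, ENNReal.mul_top (by simpa using hβ), ENNReal.mul_top (by simp; positivity),
      ENNReal.mul_top (by simp; positivity)]
    simp
  obtain ⟨y, rfl⟩ : ∃ z : NNReal, y = z := ⟨y.toNNReal, (ENNReal.coe_toNNReal hy).symm⟩
  have hset : P.real {ω | ENNReal.ofReal β * y ≤ ENNReal.ofReal (u ω * b + v ω * c)} =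
      P.real {ω | β * y ≤ u ω * b + v ω * c} := by
    refine measureReal_congr ?_
    filter_upwards [ae_pos_of_map_eq_expMeasure hu hlu, ae_pos_of_map_eq_expMeasure hv hlv]
      with ω h1 h2
    refine propext ?_
    change _ ≤ _ ↔ _ ≤ _
    rw [← ENNReal.ofReal_coe_nnreal, ← ENNReal.ofReal_mul hβ.le,
      ENNReal.ofReal_le_ofReal_iff (by positivity)]
  rw [hset, measureReal_le_add_of_map_eq_expMeasure hκ hu hv hlu hlv huv hb hc (by positivity),
    sumTail, ← ENNReal.ofReal_coe_nnreal, ← ENNReal.ofReal_mul (by positivity),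
    ← ENNReal.ofReal_mul (by positivity), expNeg_ofReal (by positivity),
    expNeg_ofReal (by positivity), ENNReal.toReal_ofReal (by positivity)]
  split_ifs with hbc
  · subst hbc
    simp only [div_self hb.ne', sub_self, mul_zero, zero_mul, Real.exp_zero,
      intervalIntegral.integral_const, smul_eq_mul, sub_zero, mul_one]
    have : κ * (β * y / b) = κ * (β / b) * y := by ring
    rw [this]
    ring
  · have hbc' : b - c ≠ 0 := sub_ne_zero.2 hbc
    have hk : κ * (b / c - 1) ≠ 0 := by
      have : b / c - 1 = (b - c) / c := by field_simp
      rw [this]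
      positivity
    rw [intervalIntegral.integral_comp_mul_left (fun x => Real.exp x) hk, integral_exp, smul_eq_mul,
      mul_zero, Real.exp_zero]
    have e1 : Real.exp (-(κ * (β * y / c))) * Real.exp (κ * (b / c - 1) * (β * y / b)) =
        Real.exp (-(κ * (β / b) * y)) := by
      rw [← Real.exp_add]
      congr 1
      field_simp
      ring
    have e2 : -(κ * (β * y / b)) = -(κ * (β / b) * y) := by ring
    have e3 : -(κ * (β * y / c)) = -(κ * (β / c) * y) := by ring
    have e4 : κ * (κ * (b / c - 1))⁻¹ = c / (b - c) := by
      field_simp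
    calc _ = Real.exp (-(κ * (β * y / b))) + κ * (κ * (b / c - 1))⁻¹ *
          (Real.exp (-(κ * (β * y / c))) * Real.exp (κ * (b / c - 1) * (β * y / b))
            - Real.exp (-(κ * (β * y / c)))) := by ring
      _ = _ := by
        rw [e1, e4, e2, e3]
        field_simp
        ring

end Exponential

/-! ### Path loss -/

lemma pathLoss_pos (α : ℝ) {d : ℝ} (hd : 0 ≤ d) : 0 < pathLoss α d := by
  unfold pathLoss
  positivity

@[fun_prop] lemma measurable_pathLoss (α : ℝ) : Measurable (pathLoss α) := by
  unfold pathLoss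
  fun_prop

/-- Comparison with `(1 + d) ^ (-α)`, integrable when `α` exceeds the dimension. The constant comes
from `1 + d ≤ 2` or `1 + d ≤ 2 * d`, according to the side of `1` on which `d` lies. -/
lemma pathLoss_le_rpow_one_add {α d : ℝ} (hα : 0 ≤ α) (hd : 0 ≤ d) :
    pathLoss α d ≤ 2 ^ α * (1 + d) ^ (-α) := by
  have h1 : (1 + d) ^ α ≤ 2 ^ α * (1 + d ^ α) := by
    rcases le_total d 1 with h | h
    · calc (1 + d) ^ α ≤ 2 ^ α := Real.rpow_le_rpow (by positivity) (by linarith) hα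
        _ ≤ 2 ^ α * (1 + d ^ α) := le_mul_of_one_le_right (by positivity)
            (le_add_of_nonneg_right (by positivity))
    · calc (1 + d) ^ α ≤ (2 * d) ^ α := Real.rpow_le_rpow (by positivity) (by linarith) hα
        _ = 2 ^ α * d ^ α := Real.mul_rpow (by norm_num) hd
        _ ≤ 2 ^ α * (1 + d ^ α) := by gcongr; linarith
  rw [pathLoss, Real.rpow_neg (by positivity), ← div_eq_mul_inv, inv_eq_one_div,
    div_le_div_iff₀ (by positivity) (by positivity), one_mul]
  exact h1

lemma integrable_pathLoss_norm {α : ℝ} (hα : 2 < α) :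
    Integrable fun x : Plane => pathLoss α ‖x‖ := by
  have hf : (Module.finrank ℝ Plane : ℝ) < α := by simpa using hα
  refine ((integrable_one_add_norm (μ := (volume : Measure Plane)) hf).const_mul (2 ^ α)).mono'
    (Measurable.aestronglyMeasurable (by fun_prop)) (.of_forall fun x => ?_)
  rw [Real.norm_of_nonneg (pathLoss_pos α (norm_nonneg x)).le]
  exact pathLoss_le_rpow_one_add (by linarith) (norm_nonneg x)

lemma integrable_pathLoss_norm_sub {α : ℝ} (hα : 2 < α) (a : Plane) :
    Integrable fun x : Plane => pathLoss α ‖x - a‖ :=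
  (integrable_pathLoss_norm hα).comp_sub_right a

/-- Rate of decay in the density of the joint Laplace transform of the two interferences. -/
noncomputable def laplaceExponent (α : ℝ) (xr : Plane) (s t : ℝ) : ℝ :=
  ∫ x : Plane, (1 - 1 / ((1 + s * pathLoss α ‖x - xr‖) * (1 + t * pathLoss α ‖x‖)))

lemma one_sub_one_div_nonneg {p q : ℝ} (hp : 0 ≤ p) (hq : 0 ≤ q) :
    0 ≤ 1 - 1 / ((1 + p) * (1 + q)) := by
  rw [sub_nonneg, div_le_one (by positivity)]
  nlinarith [mul_nonneg hp hq]

/-- A linear bound, which reduces integrability in `laplaceExponent` to that of the path loss. -/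
lemma one_sub_one_div_le {p q : ℝ} (hp : 0 ≤ p) (hq : 0 ≤ q) :
    1 - 1 / ((1 + p) * (1 + q)) ≤ p + q := by
  rw [one_sub_div (by positivity), div_le_iff₀ (by positivity)]
  nlinarith [mul_nonneg hp hq, mul_nonneg (mul_nonneg hp hq) hp, mul_nonneg (mul_nonneg hp hq) hq,
    mul_nonneg hp hp, mul_nonneg hq hq]

lemma integrable_laplaceExponent {α : ℝ} (hα : 2 < α) (xr : Plane) {s t : ℝ} (hs : 0 ≤ s)
    (ht : 0 ≤ t) : Integrable fun x : Plane =>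
      1 - 1 / ((1 + s * pathLoss α ‖x - xr‖) * (1 + t * pathLoss α ‖x‖)) := by
  refine (((integrable_pathLoss_norm_sub hα xr).const_mul s).add
    ((integrable_pathLoss_norm hα).const_mul t)).mono'
    (Measurable.aestronglyMeasurable (by fun_prop)) (.of_forall fun x => ?_)
  have hp := mul_nonneg hs (pathLoss_pos α (norm_nonneg (x - xr))).le
  have hq := mul_nonneg ht (pathLoss_pos α (norm_nonneg x)).le
  rw [Real.norm_of_nonneg (one_sub_one_div_nonneg hp hq)]
  exact one_sub_one_div_le hp hq

lemma laplaceExponent_nonneg (α : ℝ) (xr : Plane) {s t : ℝ} (hs : 0 ≤ s) (ht : 0 ≤ t) :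
    0 ≤ laplaceExponent α xr s t :=
  integral_nonneg fun x => one_sub_one_div_nonneg
    (mul_nonneg hs (pathLoss_pos α (norm_nonneg (x - xr))).le)
    (mul_nonneg ht (pathLoss_pos α (norm_nonneg x)).le)

/-! ### Joint law of the interferences -/

namespace Network.IsRayleighPoisson

variable {Ω : Type*} [MeasurableSpace Ω] {P : Measure Ω} {N : Network Ω} {lam κ : ℝ}

lemma measurable_g (h : N.IsRayleighPoisson P lam κ) (i : ℕ) : Measurable (N.g i) :=
  h.measurable_fading (.inr (.inl i))

lemma measurable_h (h : N.IsRayleighPoisson P lam κ) (i : ℕ) : Measurable (N.h i) :=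
  h.measurable_fading (.inr (.inr i))

lemma measurable_usr (h : N.IsRayleighPoisson P lam κ) : Measurable N.usr :=
  h.measurable_fading (.inl 0)

lemma measurable_usd (h : N.IsRayleighPoisson P lam κ) : Measurable N.usd :=
  h.measurable_fading (.inl 1)

lemma measurable_urd (h : N.IsRayleighPoisson P lam κ) : Measurable N.urd :=
  h.measurable_fading (.inl 2)

lemma measurable_interferenceRelay (h : N.IsRayleighPoisson P lam κ) (α : ℝ) (xr : Plane) :
    Measurable (N.interferenceRelay α xr) := by
  unfold interferenceRelay
  refine Measurable.tsum fun i => Measurable.ennreal_ofReal ?_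
  have := h.measurable_g i
  have := h.ppp.measurable i
  fun_prop

lemma measurable_interferenceDest (h : N.IsRayleighPoisson P lam κ) (α : ℝ) :
    Measurable (N.interferenceDest α) := by
  unfold interferenceDest
  refine Measurable.tsum fun i => Measurable.ennreal_ofReal ?_
  have := h.measurable_h i
  have := h.ppp.measurable i
  fun_prop

lemma indepFun_usr_usd_urd (h : N.IsRayleighPoisson P lam κ) :
    IndepFun N.usr (fun ω => (N.usd ω, N.urd ω)) P :=
  (h.fading_indep.indepFun_prodMk h.measurable_fading (.inl 1) (.inl 2) (.inl 0)
    (by simp) (by simp)).symm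

lemma indepFun_usd_urd (h : N.IsRayleighPoisson P lam κ) : IndepFun N.usd N.urd P :=
  h.fading_indep.indepFun (i := .inl 1) (j := .inl 2) (by simp)

variable [IsProbabilityMeasure P]

/-- Joint Laplace transform of the interferences at the relay and at the destination. -/
theorem integral_expNeg_interference (h : N.IsRayleighPoisson P lam κ) (hlam : 0 ≤ lam)
    (hκ : 0 < κ) {α : ℝ} (hα : 2 < α) (xr : Plane) {s t : ℝ} (hs : 0 ≤ s) (ht : 0 ≤ t) :
    ∫ ω, expNeg (ENNReal.ofReal (κ * s) * N.interferenceRelay α xr ω +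
      ENNReal.ofReal (κ * t) * N.interferenceDest α ω) ∂P =
      Real.exp (-(lam * laplaceExponent α xr s t)) := by
  -- Both interferences become one sum over `ℕ ⊕ ℕ`. The factor `κ` cancels the rate of the gains,
  -- so the result no longer contains it.
  let c : ℕ ⊕ ℕ → (ℕ → Plane) → ℝ := Sum.elim (fun i x => κ * s * pathLoss α ‖x i - xr‖)
    (fun i x => κ * t * pathLoss α ‖x i‖)
  have hc0 : ∀ k x, 0 ≤ c k x := by
    rintro (i | i) x
    · exact mul_nonneg (by positivity) (pathLoss_pos α (norm_nonneg _)).le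
    · exact mul_nonneg (by positivity) (pathLoss_pos α (norm_nonneg _)).le
  have hcm : ∀ k, Measurable (c k) := by
    rintro (i | i)
    · change Measurable fun x : ℕ → Plane => κ * s * pathLoss α ‖x i - xr‖
      fun_prop
    · change Measurable fun x : ℕ → Plane => κ * t * pathLoss α ‖x i‖
      fun_prop
  let Φ : (ℕ → Plane) × (Fin 3 ⊕ ℕ ⊕ ℕ → ℝ) → ℝ := fun z =>
    expNeg (∑' k, ENNReal.ofReal (z.2 (.inr k) * c k z.1))
  have hΦ : Measurable Φ := by
    refine measurable_expNeg.comp (Measurable.tsum fun k => Measurable.ennreal_ofReal ?_)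
    have := hcm k
    fun_prop
  have htsum : ∀ f : ℕ ⊕ ℕ → ℝ≥0∞, ∑' k, f k = ∑' i, f (.inl i) + ∑' i, f (.inr i) := fun f =>
    Summable.tsum_sum (f := f) ENNReal.summable ENNReal.summable
  have h1 : ∀ ω, expNeg (ENNReal.ofReal (κ * s) * N.interferenceRelay α xr ω +
      ENNReal.ofReal (κ * t) * N.interferenceDest α ω) =
      Φ (fun i => N.x i ω, fun k => N.fading k ω) := by
    intro ω
    simp only [Φ]
    rw [htsum, interferenceRelay, interferenceDest, ← ENNReal.tsum_mul_left,
      ← ENNReal.tsum_mul_left]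
    congr 3
    · ext i
      rw [← ENNReal.ofReal_mul (by positivity)]
      congr 1
      simp only [fading, Sum.elim_inr, Sum.elim_inl, c]
      ring
    · ext i
      rw [← ENNReal.ofReal_mul (by positivity)]
      congr 1
      simp only [fading, Sum.elim_inr, c]
      ring
  have hX : Measurable fun ω i => N.x i ω := measurable_pi_lambda _ h.ppp.measurable
  have hF : Measurable fun ω k => N.fading k ω := measurable_pi_lambda _ h.measurable_fading
  -- Averaging the gains at fixed locations leaves the sum of `w` over the points. Both logarithms
  -- sit at the same point, which is where the dependence of the two interferences enters.
  let w : Plane → ℝ≥0∞ := fun x => ENNReal.ofReal (Real.log (1 + s * pathLoss α ‖x - xr‖)) +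
    ENNReal.ofReal (Real.log (1 + t * pathLoss α ‖x‖))
  have hw : Measurable w := by fun_prop
  have hwx : ∀ x, 1 - expNeg (w x) =
      1 - 1 / ((1 + s * pathLoss α ‖x - xr‖) * (1 + t * pathLoss α ‖x‖)) := by
    intro x
    have hp := mul_nonneg hs (pathLoss_pos α (norm_nonneg (x - xr))).le
    have hq := mul_nonneg ht (pathLoss_pos α (norm_nonneg x)).le
    simp only [w]
    rw [expNeg_add, expNeg_ofReal (Real.log_nonneg (by linarith)),
      expNeg_ofReal (Real.log_nonneg (by linarith)), Real.exp_neg, Real.exp_neg,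
      Real.exp_log (by positivity), Real.exp_log (by positivity), ← mul_inv, one_div]
  simp_rw [h1]
  rw [h.fading_indep_locations.integral_comp_prodMk hX hF hΦ (C := 1) fun z => by
    rw [Real.norm_of_nonneg (expNeg_nonneg _)]
    exact expNeg_le_one _]
  have h2 : ∀ ω₁, ∫ ω₂, Φ (fun i => N.x i ω₁, fun k => N.fading k ω₂) ∂P =
      expNeg (∑' i, w (N.x i ω₁)) := by
    intro ω₁
    simp only [Φ]
    rw [integral_expNeg_tsum_ofReal_mul hκ (Y := fun k => N.fading (.inr k))
      (fun k => h.measurable_fading _) (fun k => h.fading_law _)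
      (h.fading_indep.precomp Sum.inr_injective) (fun k => hc0 k _), htsum, ← ENNReal.tsum_add]
    congr 2
    ext i
    simp only [c, w, Sum.elim_inl, Sum.elim_inr]
    congr 4
    · field_simp
    · field_simp
  simp_rw [h2]
  rw [h.ppp.integral_expNeg_tsum hlam hw]
  simp_rw [hwx]
  rw [← ofReal_integral_eq_lintegral_ofReal (integrable_laplaceExponent hα xr hs ht)
    (.of_forall fun x => one_sub_one_div_nonneg
      (mul_nonneg hs (pathLoss_pos α (norm_nonneg (x - xr))).le)
      (mul_nonneg ht (pathLoss_pos α (norm_nonneg x)).le)),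
    ← ENNReal.ofReal_mul hlam]
  exact expNeg_ofReal (mul_nonneg hlam (laplaceExponent_nonneg α xr hs ht))

/-- The locations are independent of all gains and the interferers' gains are independent of the
link gains, so locations and interferers' gains together are independent of the links. -/
lemma indepFun_interference_links (h : N.IsRayleighPoisson P lam κ) (α : ℝ) (xr : Plane) :
    IndepFun (fun ω => (N.interferenceRelay α xr ω, N.interferenceDest α ω))
      (fun ω => (N.usr ω, N.usd ω, N.urd ω)) P := by
  have hX : Measurable fun ω i => N.x i ω := measurable_pi_lambda _ h.ppp.measurable
  have hU : Measurable fun ω i => N.fading (.inl i) ω :=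
    measurable_pi_lambda _ fun i => h.measurable_fading _
  have hG : Measurable fun ω k => N.fading (.inr k) ω :=
    measurable_pi_lambda _ fun k => h.measurable_fading _
  have h1 : IndepFun (fun ω i => N.x i ω)
      (fun ω => (fun k => N.fading (.inr k) ω, fun i => N.fading (.inl i) ω)) P :=
    h.fading_indep_locations.comp (φ := id)
      (ψ := fun f : Fin 3 ⊕ ℕ ⊕ ℕ → ℝ => (fun k => f (.inr k), fun i => f (.inl i)))
      measurable_id (by fun_prop)
  have h2 := h1.prodMk_left_of_prodMk_right hX hG hU
    (h.fading_indep.indepFun_inl_inr h.measurable_fading).symm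
  refine h2.comp
    (φ := fun z : (ℕ → Plane) × (ℕ ⊕ ℕ → ℝ) =>
      (∑' i, ENNReal.ofReal (z.2 (.inl i) * pathLoss α ‖z.1 i - xr‖),
        ∑' i, ENNReal.ofReal (z.2 (.inr i) * pathLoss α ‖z.1 i‖)))
    (ψ := fun u : Fin 3 → ℝ => (u 0, u 1, u 2)) ?_ (by fun_prop)
  refine Measurable.prodMk (Measurable.tsum fun i => ?_) (Measurable.tsum fun i => ?_) <;>
    fun_prop

/-- Averaging over the desired links: the events depend on the link gains through `A` and `B`. -/
lemma measureReal_links (h : N.IsRayleighPoisson P lam κ) (α : ℝ) (xr : Plane)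
    {A : ℝ≥0∞ → Set ℝ} {B : ℝ≥0∞ → Set (ℝ × ℝ)}
    (hA : MeasurableSet {z : ℝ≥0∞ × ℝ | z.2 ∈ A z.1})
    (hB : MeasurableSet {z : ℝ≥0∞ × ℝ × ℝ | z.2 ∈ B z.1}) :
    P.real {ω | N.usr ω ∈ A (N.interferenceRelay α xr ω) ∧
      (N.usd ω, N.urd ω) ∈ B (N.interferenceDest α ω)} =
    ∫ ω, P.real {ω' | N.usr ω' ∈ A (N.interferenceRelay α xr ω)} *
      P.real {ω' | (N.usd ω', N.urd ω') ∈ B (N.interferenceDest α ω)} ∂P := by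
  have hr := h.measurable_interferenceRelay α xr
  have hd := h.measurable_interferenceDest α
  have hu := h.measurable_usr
  have hv := h.measurable_usd.prodMk h.measurable_urd
  let S : Set ((ℝ≥0∞ × ℝ≥0∞) × ℝ × ℝ × ℝ) := {z | z.2.1 ∈ A z.1.1 ∧ z.2.2 ∈ B z.1.2}
  have hS : MeasurableSet S := by
    refine MeasurableSet.inter ?_ ?_
    · exact hA.preimage (f := fun z : (ℝ≥0∞ × ℝ≥0∞) × ℝ × ℝ × ℝ => (z.1.1, z.2.1)) (by fun_prop)
    · exact hB.preimage (f := fun z : (ℝ≥0∞ × ℝ≥0∞) × ℝ × ℝ × ℝ => (z.1.2, z.2.2)) (by fun_prop)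
  have h1 : P.real {ω | N.usr ω ∈ A (N.interferenceRelay α xr ω) ∧
      (N.usd ω, N.urd ω) ∈ B (N.interferenceDest α ω)} =
      ∫ ω, S.indicator 1 ((N.interferenceRelay α xr ω, N.interferenceDest α ω),
        (N.usr ω, N.usd ω, N.urd ω)) ∂P := by
    have hm : MeasurableSet {ω | N.usr ω ∈ A (N.interferenceRelay α xr ω) ∧
      (N.usd ω, N.urd ω) ∈ B (N.interferenceDest α ω)} :=
      hS.preimage ((hr.prodMk hd).prodMk (hu.prodMk hv))
    rw [← integral_indicator_one hm]
    rfl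
  rw [h1, (h.indepFun_interference_links α xr).integral_comp_prodMk (hr.prodMk hd) (hu.prodMk hv)
    (measurable_one.indicator hS) (C := 1) (fun z => by
      refine (norm_indicator_le_norm_self _ _).trans ?_
      simp)]
  congr 1
  ext ω
  have hmA : MeasurableSet (A (N.interferenceRelay α xr ω)) :=
    hA.preimage measurable_prodMk_left
  have hmB : MeasurableSet (B (N.interferenceDest α ω)) :=
    hB.preimage measurable_prodMk_left
  have h2 := h.indepFun_usr_usd_urd.measure_inter_preimage_eq_mul _ _ hmA hmB
  have h3 : MeasurableSet {ω' | N.usr ω' ∈ A (N.interferenceRelay α xr ω) ∧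
      (N.usd ω', N.urd ω') ∈ B (N.interferenceDest α ω)} :=
    (hu hmA).inter (hv hmB)
  calc _ = ∫ ω', {ω' | N.usr ω' ∈ A (N.interferenceRelay α xr ω) ∧
      (N.usd ω', N.urd ω') ∈ B (N.interferenceDest α ω)}.indicator (1 : Ω → ℝ) ω' ∂P := rfl
    _ = _ := by
      rw [integral_indicator_one h3, measureReal_def, measureReal_def, measureReal_def,
        ← ENNReal.toReal_mul]
      exact congrArg ENNReal.toReal h2

end Network.IsRayleighPoisson

/-! ### Outage probabilities -/

/-- Differentiation of a Laplace transform under the expectation. -/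
lemma hasDerivAt_integral_expNeg_add_mul {Ω : Type*} [MeasurableSpace Ω] {P : Measure Ω}
    [IsFiniteMeasure P] {X Y : Ω → ℝ≥0∞} (hX : Measurable X) (hY : Measurable Y) {t : ℝ}
    (ht : 0 < t) :
    Integrable (fun ω => (Y ω).toReal * expNeg (X ω + ENNReal.ofReal t * Y ω)) P ∧
    HasDerivAt (fun τ => ∫ ω, expNeg (X ω + ENNReal.ofReal τ * Y ω) ∂P)
      (-∫ ω, (Y ω).toReal * expNeg (X ω + ENNReal.ofReal t * Y ω) ∂P) t := by
  have hm : ∀ τ : ℝ, Measurable fun ω => expNeg (X ω + ENNReal.ofReal τ * Y ω) := fun τ => by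
    fun_prop
  -- Restricting to `τ > t / 2` gives a constant dominating function: `z ≤ exp z` yields `y * exp
  -- (-(τ * y)) ≤ 1 / τ ≤ 2 / t`.
  have key := hasDerivAt_integral_of_dominated_loc_of_deriv_le (μ := P) (𝕜 := ℝ) (x₀ := t)
    (F := fun τ ω => expNeg (X ω + ENNReal.ofReal τ * Y ω))
    (F' := fun τ ω => -((Y ω).toReal * expNeg (X ω + ENNReal.ofReal τ * Y ω)))
    (bound := fun _ => 2 / t) (s := Set.Ioi (t / 2)) (Ioi_mem_nhds (by linarith))
    (.of_forall fun τ => (hm τ).aestronglyMeasurable)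
    (integrable_expNeg_comp (by fun_prop))
    ((hY.ennreal_toReal.mul (hm t)).neg.aestronglyMeasurable)
    (.of_forall fun ω τ hτ => ?_) (integrable_const _) (.of_forall fun ω τ hτ => ?_)
  · refine ⟨?_, ?_⟩
    · simpa using key.1.neg
    · rw [← integral_neg]
      exact key.2
  · have hτ' : t / 2 < τ := hτ
    have hτ0 : 0 < τ := by linarith
    rw [norm_neg, Real.norm_of_nonneg (mul_nonneg ENNReal.toReal_nonneg (expNeg_nonneg _))]
    by_cases hy : Y ω = ∞
    · rw [hy]
      simp
      positivity
    · have h1 : expNeg (X ω + ENNReal.ofReal τ * Y ω) ≤ Real.exp (-(τ * (Y ω).toReal)) := by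
        rw [expNeg_add, ← ENNReal.ofReal_toReal hy, ← ENNReal.ofReal_mul hτ0.le,
          expNeg_ofReal (by positivity), ENNReal.toReal_ofReal ENNReal.toReal_nonneg]
        exact mul_le_of_le_one_left (Real.exp_pos _).le (expNeg_le_one _)
      have h2 : τ * (Y ω).toReal ≤ Real.exp (τ * (Y ω).toReal) := by
        linarith [Real.add_one_le_exp (τ * (Y ω).toReal)]
      have h3 : τ * (Y ω).toReal * Real.exp (-(τ * (Y ω).toReal)) ≤ 1 := by
        rw [Real.exp_neg, ← div_eq_mul_inv]
        exact (div_le_one (Real.exp_pos _)).2 h2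
      have h4 : (Y ω).toReal * Real.exp (-(τ * (Y ω).toReal)) ≤ 1 / τ := by
        rw [le_div_iff₀ hτ0]
        linarith
      calc _ ≤ (Y ω).toReal * Real.exp (-(τ * (Y ω).toReal)) := by gcongr
        _ ≤ 1 / τ := h4
        _ ≤ 2 / t := by
          rw [div_le_div_iff₀ hτ0 ht]
          linarith
  · have hτ' : t / 2 < τ := hτ
    have hτ0 : 0 < τ := by linarith
    by_cases hx : X ω = ∞
    · simp [hx, hasDerivAt_const]
    -- Here the integrand is zero for all positive parameters, so its derivative is zero, in
    -- agreement with `∞.toReal = 0`.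
    by_cases hy : Y ω = ∞
    · simp only [hy]
      have : (fun τ' => expNeg (X ω + ENNReal.ofReal τ' * ∞)) =ᶠ[𝓝 τ] fun _ => 0 := by
        filter_upwards [Ioi_mem_nhds hτ0] with τ' h'
        rw [ENNReal.mul_top (by simpa using h')]
        simp
      simpa using (hasDerivAt_const τ (0 : ℝ)).congr_of_eventuallyEq this
    · have hform : ∀ τ' > 0, expNeg (X ω + ENNReal.ofReal τ' * Y ω) =
          Real.exp (-((X ω).toReal + τ' * (Y ω).toReal)) := by
        intro τ' h'
        have hmul : ENNReal.ofReal τ' * Y ω ≠ ∞ := ENNReal.mul_ne_top ENNReal.ofReal_ne_top hy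
        rw [expNeg_of_ne_top (ENNReal.add_ne_top.2 ⟨hx, hmul⟩), ENNReal.toReal_add hx hmul,
          ENNReal.toReal_mul, ENNReal.toReal_ofReal h'.le]
      have : (fun τ' => expNeg (X ω + ENNReal.ofReal τ' * Y ω)) =ᶠ[𝓝 τ]
          fun τ' => Real.exp (-((X ω).toReal + τ' * (Y ω).toReal)) := by
        filter_upwards [Ioi_mem_nhds hτ0] with τ' h'
        exact hform τ' h'
      have hd : HasDerivAt (fun τ' => Real.exp (-((X ω).toReal + τ' * (Y ω).toReal)))
          (Real.exp (-((X ω).toReal + τ * (Y ω).toReal)) * (-(1 * (Y ω).toReal))) τ :=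
        (((hasDerivAt_id τ).mul_const _).const_add _).neg.exp
      refine (hd.congr_of_eventuallyEq this).congr_deriv ?_
      rw [hform τ hτ0]
      ring

/-- Differentiation of `laplaceExponent` in its last argument, under the integral sign. -/
lemma hasDerivAt_laplaceExponent {α : ℝ} (hα : 2 < α) (xr : Plane) {s t : ℝ} (hs : 0 ≤ s)
    (ht : 0 < t) :
    Integrable (fun x : Plane => pathLoss α ‖x‖ /
      ((1 + s * pathLoss α ‖x - xr‖) * (1 + t * pathLoss α ‖x‖) ^ 2)) ∧
    HasDerivAt (laplaceExponent α xr s) (∫ x : Plane, pathLoss α ‖x‖ /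
      ((1 + s * pathLoss α ‖x - xr‖) * (1 + t * pathLoss α ‖x‖) ^ 2)) t := by
  refine hasDerivAt_integral_of_dominated_loc_of_deriv_le (μ := (volume : Measure Plane))
    (𝕜 := ℝ) (x₀ := t)
    (F := fun τ x => 1 - 1 / ((1 + s * pathLoss α ‖x - xr‖) * (1 + τ * pathLoss α ‖x‖)))
    (F' := fun τ x => pathLoss α ‖x‖ /
      ((1 + s * pathLoss α ‖x - xr‖) * (1 + τ * pathLoss α ‖x‖) ^ 2))
    (bound := fun x => pathLoss α ‖x‖) (s := Set.Ioi 0) (Ioi_mem_nhds ht)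
    (.of_forall fun τ => Measurable.aestronglyMeasurable (by fun_prop))
    (integrable_laplaceExponent hα xr hs ht.le)
    (Measurable.aestronglyMeasurable (by fun_prop))
    (.of_forall fun x τ hτ => ?_) (integrable_pathLoss_norm hα) (.of_forall fun x τ hτ => ?_)
  · have hτ' : 0 < τ := hτ
    have hp := mul_nonneg hs (pathLoss_pos α (norm_nonneg (x - xr))).le
    have hl := pathLoss_pos α (norm_nonneg x)
    have hq := mul_nonneg hτ'.le hl.le
    rw [Real.norm_of_nonneg (by positivity)]
    refine div_le_self hl.le ?_
    have : 1 ≤ (1 + τ * pathLoss α ‖x‖) ^ 2 := one_le_pow₀ (by linarith)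
    exact one_le_mul_of_one_le_of_one_le (by linarith) this
  · have hτ' : 0 < τ := hτ
    have hp := mul_nonneg hs (pathLoss_pos α (norm_nonneg (x - xr))).le
    have hl := pathLoss_pos α (norm_nonneg x)
    have hq := mul_nonneg hτ'.le hl.le
    have hne : (1 + s * pathLoss α ‖x - xr‖) * (1 + τ * pathLoss α ‖x‖) ≠ 0 := by positivity
    have := (((((hasDerivAt_id τ).mul_const (pathLoss α ‖x‖)).const_add 1).const_mul
      (1 + s * pathLoss α ‖x - xr‖)).inv hne).const_sub 1
    simp only [one_div]
    refine this.congr_deriv ?_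
    simp only [id]
    field_simp

/-! ### Outage probabilities in terms of `laplaceExponent`. -/

namespace Network.IsRayleighPoisson

variable {Ω : Type*} [MeasurableSpace Ω] {P : Measure Ω} {N : Network Ω}
  {lam κ : ℝ}

lemma ae_pos_links (h : N.IsRayleighPoisson P lam κ) :
    ∀ᵐ ω ∂P, 0 < N.usr ω ∧ 0 < N.usd ω ∧ 0 < N.urd ω := by
  filter_upwards [ae_pos_of_map_eq_expMeasure h.measurable_usr (h.fading_law (.inl 0)),
    ae_pos_of_map_eq_expMeasure h.measurable_usd (h.fading_law (.inl 1)),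
    ae_pos_of_map_eq_expMeasure h.measurable_urd (h.fading_law (.inl 2))] with ω h1 h2 h3
  exact ⟨h1, h2, h3⟩

variable [IsProbabilityMeasure P]

lemma outageBC_eq_integral (h : N.IsRayleighPoisson P lam κ) (hκ : 0 < κ) (α : ℝ) {β : ℝ}
    (hβ : 0 < β) (xs xr : Plane) :
    N.outageBC P α β xs xr =
      ∫ ω, (1 - expNeg (ENNReal.ofReal (κ * (β / pathLoss α ‖xs - xr‖)) *
          N.interferenceRelay α xr ω)) *
        (1 - expNeg (ENNReal.ofReal (κ * (β / (2 * pathLoss α ‖xs‖))) *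
          N.interferenceDest α ω)) ∂P := by
  have ha := pathLoss_pos α (norm_nonneg (xs - xr))
  have hb := pathLoss_pos α (norm_nonneg xs)
  let A : ℝ≥0∞ → Set ℝ := fun y =>
    {u | ¬ ENNReal.ofReal β * y ≤ ENNReal.ofReal (u * pathLoss α ‖xs - xr‖)}
  let B : ℝ≥0∞ → Set (ℝ × ℝ) := fun y =>
    {v | ¬ ENNReal.ofReal β * y ≤ ENNReal.ofReal (v.1 * (2 * pathLoss α ‖xs‖))}
  have h1 : N.outageBC P α β xs xr = P.real {ω | N.usr ω ∈ A (N.interferenceRelay α xr ω) ∧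
      (N.usd ω, N.urd ω) ∈ B (N.interferenceDest α ω)} := by
    refine measureReal_congr ?_
    -- Positive gains exclude the quotient `0 / 0`, so the SIR inequalities can be cleared of
    -- denominators even when an interference is `0` or `∞`.
    filter_upwards [h.ae_pos_links] with ω hω
    obtain ⟨h1, h2, h3⟩ := hω
    refine propext ?_
    change _ ∧ _ ↔ ¬ _ ∧ ¬ _
    rw [and_comm, not_le, not_le, sirSD, sirSR,
      ENNReal.div_lt_iff (.inr (by simp; positivity)) (.inr ENNReal.ofReal_ne_top),
      ENNReal.div_lt_iff (.inr (by simp; positivity)) (.inr ENNReal.ofReal_ne_top)]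
    have : 2 * N.usd ω * pathLoss α ‖xs‖ = N.usd ω * (2 * pathLoss α ‖xs‖) := by ring
    rw [this]
  rw [h1, h.measureReal_links α xr (A := A) (B := B)]
  · congr 1
    ext ω
    congr 1
    · rw [← measureReal_ofReal_mul_le hκ h.measurable_usr (h.fading_law (.inl 0)) ha hβ]
      exact probReal_compl_eq_one_sub (measurableSet_le measurable_const
        (h.measurable_usr.mul_const _).ennreal_ofReal)
    · rw [← measureReal_ofReal_mul_le hκ h.measurable_usd (h.fading_law (.inl 1))
        (by positivity : 0 < 2 * pathLoss α ‖xs‖) hβ]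
      exact probReal_compl_eq_one_sub (measurableSet_le measurable_const
        (h.measurable_usd.mul_const _).ennreal_ofReal)
  · have : MeasurableSet {z : ℝ≥0∞ × ℝ | ENNReal.ofReal β * z.1 ≤ ENNReal.ofReal (z.2 * pathLoss α ‖xs - xr‖)} :=
      measurableSet_le (by fun_prop) (by fun_prop)
    exact this.compl
  · have : MeasurableSet {z : ℝ≥0∞ × ℝ × ℝ | ENNReal.ofReal β * z.1 ≤ ENNReal.ofReal (z.2.1 * (2 * pathLoss α ‖xs‖))} :=
      measurableSet_le (by fun_prop) (by fun_prop)
    exact this.compl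

lemma outageMAC_eq_integral (h : N.IsRayleighPoisson P lam κ) (hκ : 0 < κ) (α : ℝ) {β : ℝ}
    (hβ : 0 < β) (xs xr : Plane) :
    N.outageMAC P α β xs xr =
      ∫ ω, expNeg (ENNReal.ofReal (κ * (β / pathLoss α ‖xs - xr‖)) *
          N.interferenceRelay α xr ω) *
        (1 - sumTail κ β (pathLoss α ‖xs‖) (pathLoss α ‖xr‖) (N.interferenceDest α ω)) ∂P := by
  have ha := pathLoss_pos α (norm_nonneg (xs - xr))
  have hb := pathLoss_pos α (norm_nonneg xs)
  have hc := pathLoss_pos α (norm_nonneg xr)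
  let A : ℝ≥0∞ → Set ℝ := fun y =>
    {u | ENNReal.ofReal β * y ≤ ENNReal.ofReal (u * pathLoss α ‖xs - xr‖)}
  let B : ℝ≥0∞ → Set (ℝ × ℝ) := fun y =>
    {v | ¬ ENNReal.ofReal β * y ≤ ENNReal.ofReal (v.1 * pathLoss α ‖xs‖ + v.2 * pathLoss α ‖xr‖)}
  have h1 : N.outageMAC P α β xs xr = P.real {ω | N.usr ω ∈ A (N.interferenceRelay α xr ω) ∧
      (N.usd ω, N.urd ω) ∈ B (N.interferenceDest α ω)} := by
    refine measureReal_congr ?_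
    filter_upwards [h.ae_pos_links] with ω hω
    obtain ⟨h1, h2, h3⟩ := hω
    refine propext ?_
    change _ ∧ _ ↔ _ ∧ ¬ _
    rw [and_comm, not_le, sirSRD, sirSR,
      ENNReal.div_lt_iff (.inr (by simp; positivity)) (.inr ENNReal.ofReal_ne_top),
      ENNReal.le_div_iff_mul_le (.inr (by simp; positivity)) (.inr ENNReal.ofReal_ne_top)]
    rfl
  rw [h1, h.measureReal_links α xr (A := A) (B := B)]
  · congr 1
    ext ω
    congr 1
    · exact measureReal_ofReal_mul_le hκ h.measurable_usr (h.fading_law (.inl 0)) ha hβ _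
    · rw [← measureReal_ofReal_mul_add_le hκ h.measurable_usd h.measurable_urd
        (h.fading_law (.inl 1)) (h.fading_law (.inl 2)) h.indepFun_usd_urd hb hc hβ]
      exact probReal_compl_eq_one_sub (measurableSet_le measurable_const
        ((h.measurable_usd.mul_const _).add (h.measurable_urd.mul_const _)).ennreal_ofReal)
  · have : MeasurableSet {z : ℝ≥0∞ × ℝ |
        ENNReal.ofReal β * z.1 ≤ ENNReal.ofReal (z.2 * pathLoss α ‖xs - xr‖)} :=
      measurableSet_le (by fun_prop) (by fun_prop)
    exact this
  · have : MeasurableSet {z : ℝ≥0∞ × ℝ × ℝ | ENNReal.ofReal β * z.1 ≤ ENNReal.ofReal (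
        z.2.1 * pathLoss α ‖xs‖ + z.2.2 * pathLoss α ‖xr‖)} :=
      measurableSet_le (by fun_prop) (by fun_prop)
    exact this.compl

lemma outageBC_eq (h : N.IsRayleighPoisson P lam κ) (hlam : 0 ≤ lam) (hκ : 0 < κ) {α : ℝ}
    (hα : 2 < α) {β : ℝ} (hβ : 0 < β) (xs xr : Plane) :
    N.outageBC P α β xs xr =
      1 - Real.exp (-(lam * laplaceExponent α xr (β / pathLoss α ‖xs - xr‖) 0))
        - Real.exp (-(lam * laplaceExponent α xr 0 (β / (2 * pathLoss α ‖xs‖))))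
        + Real.exp (-(lam * laplaceExponent α xr (β / pathLoss α ‖xs - xr‖)
            (β / (2 * pathLoss α ‖xs‖)))) := by
  have ha := pathLoss_pos α (norm_nonneg (xs - xr))
  have hb := pathLoss_pos α (norm_nonneg xs)
  set s := β / pathLoss α ‖xs - xr‖
  set t := β / (2 * pathLoss α ‖xs‖)
  have hs : 0 ≤ s := by positivity
  have ht : 0 ≤ t := by positivity
  have hr := h.measurable_interferenceRelay α xr
  have hd := h.measurable_interferenceDest α
  rw [h.outageBC_eq_integral hκ α hβ, ← h.integral_expNeg_interference hlam hκ hα xr hs le_rfl,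
    ← h.integral_expNeg_interference hlam hκ hα xr le_rfl ht,
    ← h.integral_expNeg_interference hlam hκ hα xr hs ht]
  have hi : ∀ p q : ℝ≥0∞, Integrable (fun ω => expNeg (p * N.interferenceRelay α xr ω +
      q * N.interferenceDest α ω)) P := fun p q => integrable_expNeg_comp (by fun_prop)
  have h1 : (1 : ℝ) = ∫ ω, (1 : ℝ) ∂P := by simp
  conv_rhs => enter [1, 1, 1]; rw [h1]
  rw [← integral_sub (integrable_const _) (hi _ _), ← integral_sub (by
    exact (integrable_const _).sub (hi _ _)) (hi _ _), ← integral_add (by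
    exact ((integrable_const _).sub (hi _ _)).sub (hi _ _)) (hi _ _)]
  congr 1
  ext ω
  simp only [mul_zero, ENNReal.ofReal_zero, zero_mul, add_zero, zero_add, expNeg_add]
  ring

lemma outageMAC_eq_of_ne (h : N.IsRayleighPoisson P lam κ) (hlam : 0 ≤ lam) (hκ : 0 < κ)
    {α : ℝ} (hα : 2 < α) {β : ℝ} (hβ : 0 < β) (xs xr : Plane)
    (hne : pathLoss α ‖xs‖ ≠ pathLoss α ‖xr‖) :
    N.outageMAC P α β xs xr =
      Real.exp (-(lam * laplaceExponent α xr (β / pathLoss α ‖xs - xr‖) 0))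
      - pathLoss α ‖xs‖ / (pathLoss α ‖xs‖ - pathLoss α ‖xr‖) *
        Real.exp (-(lam * laplaceExponent α xr (β / pathLoss α ‖xs - xr‖)
          (β / pathLoss α ‖xs‖)))
      + pathLoss α ‖xr‖ / (pathLoss α ‖xs‖ - pathLoss α ‖xr‖) *
        Real.exp (-(lam * laplaceExponent α xr (β / pathLoss α ‖xs - xr‖)
          (β / pathLoss α ‖xr‖))) := by
  have ha := pathLoss_pos α (norm_nonneg (xs - xr))
  have hb := pathLoss_pos α (norm_nonneg xs)
  have hc := pathLoss_pos α (norm_nonneg xr)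
  set s := β / pathLoss α ‖xs - xr‖
  set b := pathLoss α ‖xs‖
  set c := pathLoss α ‖xr‖
  have hs : 0 ≤ s := by positivity
  have hr := h.measurable_interferenceRelay α xr
  have hd := h.measurable_interferenceDest α
  rw [h.outageMAC_eq_integral hκ α hβ, ← h.integral_expNeg_interference hlam hκ hα xr hs le_rfl,
    ← h.integral_expNeg_interference hlam hκ hα xr hs (by positivity : 0 ≤ β / b),
    ← h.integral_expNeg_interference hlam hκ hα xr hs (by positivity : 0 ≤ β / c)]
  have hi : ∀ p q : ℝ≥0∞, Integrable (fun ω => expNeg (p * N.interferenceRelay α xr ω +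
      q * N.interferenceDest α ω)) P := fun p q => integrable_expNeg_comp (by fun_prop)
  rw [← integral_const_mul, ← integral_const_mul,
    ← integral_sub (hi _ _) ((hi _ _).const_mul _), ← integral_add (by
    exact (hi _ _).sub ((hi _ _).const_mul _)) ((hi _ _).const_mul _)]
  congr 1
  ext ω
  rw [sumTail, if_neg hne]
  simp only [mul_zero, ENNReal.ofReal_zero, zero_mul, add_zero, expNeg_add]
  ring

/-- The Laplace transform is differentiated in `t` in two ways, under the expectation and through
its closed form. This evaluates the linear term of `sumTail` for equal path losses. -/
lemma integral_toReal_mul_expNeg_interference (h : N.IsRayleighPoisson P lam κ)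
    (hlam : 0 ≤ lam) (hκ : 0 < κ) {α : ℝ} (hα : 2 < α) (xr : Plane) {s t : ℝ} (hs : 0 ≤ s)
    (ht : 0 < t) :
    Integrable (fun ω => (ENNReal.ofReal (κ * t) * N.interferenceDest α ω).toReal *
      expNeg (ENNReal.ofReal (κ * s) * N.interferenceRelay α xr ω +
        ENNReal.ofReal (κ * t) * N.interferenceDest α ω)) P ∧
    ∫ ω, (ENNReal.ofReal (κ * t) * N.interferenceDest α ω).toReal *
      expNeg (ENNReal.ofReal (κ * s) * N.interferenceRelay α xr ω +
        ENNReal.ofReal (κ * t) * N.interferenceDest α ω) ∂P =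
    lam * (t * deriv (laplaceExponent α xr s) t) *
      Real.exp (-(lam * laplaceExponent α xr s t)) := by
  have hr := h.measurable_interferenceRelay α xr
  have hd := h.measurable_interferenceDest α
  have hmul : ∀ τ ω, ENNReal.ofReal (κ * τ) * N.interferenceDest α ω =
      ENNReal.ofReal τ * (ENNReal.ofReal κ * N.interferenceDest α ω) := by
    intro τ ω
    rw [ENNReal.ofReal_mul hκ.le]
    ring
  have htr : ∀ ω, (ENNReal.ofReal (κ * t) * N.interferenceDest α ω).toReal =
      t * (ENNReal.ofReal κ * N.interferenceDest α ω).toReal := by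
    intro ω
    rw [hmul, ENNReal.toReal_mul, ENNReal.toReal_ofReal ht.le]
  obtain ⟨hint, hder⟩ := hasDerivAt_integral_expNeg_add_mul (P := P)
    (X := fun ω => ENNReal.ofReal (κ * s) * N.interferenceRelay α xr ω)
    (Y := fun ω => ENNReal.ofReal κ * N.interferenceDest α ω) (by fun_prop) (by fun_prop) ht
  have heq : (fun τ => ∫ ω, expNeg (ENNReal.ofReal (κ * s) * N.interferenceRelay α xr ω +
      ENNReal.ofReal τ * (ENNReal.ofReal κ * N.interferenceDest α ω)) ∂P) =ᶠ[𝓝 t]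
      fun τ => Real.exp (-(lam * laplaceExponent α xr s τ)) := by
    filter_upwards [Ioi_mem_nhds ht] with τ hτ
    rw [← h.integral_expNeg_interference hlam hκ hα xr hs (le_of_lt hτ)]
    simp_rw [hmul]
  have hL := ((((hasDerivAt_laplaceExponent hα xr hs ht).2.differentiableAt.hasDerivAt).const_mul
    lam).neg.exp).congr_of_eventuallyEq heq
  have huniq := hder.unique hL
  simp_rw [htr, mul_assoc, integral_const_mul]
  refine ⟨?_, ?_⟩
  · simp_rw [hmul]
    exact hint.const_mul t
  · simp_rw [hmul]
    rw [neg_eq_iff_eq_neg.1 huniq]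
    simp only [Pi.neg_apply]
    ring

lemma outageMAC_eq_of_eq (h : N.IsRayleighPoisson P lam κ) (hlam : 0 ≤ lam) (hκ : 0 < κ)
    {α : ℝ} (hα : 2 < α) {β : ℝ} (hβ : 0 < β) (xs xr : Plane)
    (heq : pathLoss α ‖xs‖ = pathLoss α ‖xr‖) :
    N.outageMAC P α β xs xr =
      Real.exp (-(lam * laplaceExponent α xr (β / pathLoss α ‖xs - xr‖) 0))
      - Real.exp (-(lam * laplaceExponent α xr (β / pathLoss α ‖xs - xr‖)
          (β / pathLoss α ‖xs‖)))
      - lam * (β / pathLoss α ‖xs‖ * deriv (laplaceExponent α xr (β / pathLoss α ‖xs - xr‖))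
          (β / pathLoss α ‖xs‖)) *
        Real.exp (-(lam * laplaceExponent α xr (β / pathLoss α ‖xs - xr‖)
          (β / pathLoss α ‖xs‖))) := by
  have ha := pathLoss_pos α (norm_nonneg (xs - xr))
  have hb := pathLoss_pos α (norm_nonneg xs)
  rw [h.outageMAC_eq_integral hκ α hβ, ← heq]
  set s := β / pathLoss α ‖xs - xr‖
  set b := pathLoss α ‖xs‖
  have hs : 0 ≤ s := by positivity
  have hr := h.measurable_interferenceRelay α xr
  have hd := h.measurable_interferenceDest α
  obtain ⟨hint, hval⟩ := h.integral_toReal_mul_expNeg_interference hlam hκ hα xr hs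
    (by positivity : 0 < β / b)
  rw [← hval, ← h.integral_expNeg_interference hlam hκ hα xr hs le_rfl,
    ← h.integral_expNeg_interference hlam hκ hα xr hs (by positivity : 0 ≤ β / b)]
  have hi : ∀ p q : ℝ≥0∞, Integrable (fun ω => expNeg (p * N.interferenceRelay α xr ω +
      q * N.interferenceDest α ω)) P := fun p q => integrable_expNeg_comp (by fun_prop)
  rw [← integral_sub (hi _ _) (hi _ _), ← integral_sub (by exact (hi _ _).sub (hi _ _)) hint]
  congr 1
  ext ω
  rw [sumTail, if_pos rfl]
  simp only [mul_zero, ENNReal.ofReal_zero, zero_mul, add_zero, expNeg_add]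
  ring

lemma outage_eq_add (h : N.IsRayleighPoisson P lam κ) (α β : ℝ) (xs xr : Plane) :
    N.outage P α β xs xr = N.outageBC P α β xs xr + N.outageMAC P α β xs xr := by
  have hr := h.measurable_interferenceRelay α xr
  have hd := h.measurable_interferenceDest α
  have hu := h.measurable_usr
  have hv := h.measurable_usd
  have hw := h.measurable_urd
  have hsr : Measurable (N.sirSR α xs xr) := by
    unfold sirSR
    fun_prop
  have hsrd : Measurable (N.sirSRD α xs xr) := by
    unfold sirSRD
    fun_prop
  rw [outage, outageBC, outageMAC, ← measureReal_union]
  · congr 1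
    ext ω
    simp only [sirSDF, Set.mem_ofPred_eq, Set.mem_union]
    split_ifs with hc
    · simp [hc]
    · simp only [hc, and_false, or_false]
      simp [not_le.1 hc]
  · exact Set.disjoint_left.2 fun ω h1 h2 => absurd h1.2 (not_lt.2 h2.2)
  · exact (measurableSet_lt hsrd measurable_const).inter (measurableSet_le measurable_const hsr)

end Network.IsRayleighPoisson

/-! ### Polar coordinates -/

/-- A rotation puts the relay on the nonnegative real axis, so that polar angles are measured from
its direction, as in `relLossSR`. -/
lemma exists_linearIsometryEquiv_complex (a : Plane) :
    ∃ e : ℂ ≃ₗᵢ[ℝ] Plane, e (‖a‖ : ℂ) = a := by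
  let e₀ : ℂ ≃ₗᵢ[ℝ] Plane := Complex.orthonormalBasisOneI.repr
  refine ⟨(rotation (Circle.exp (e₀.symm a).arg)).trans e₀, ?_⟩
  have : ‖a‖ = ‖e₀.symm a‖ := (e₀.symm.norm_map a).symm
  rw [LinearIsometryEquiv.trans_apply, rotation_apply, Circle.coe_exp, mul_comm, this,
    Complex.norm_mul_exp_arg_mul_I, LinearIsometryEquiv.apply_symm_apply]

lemma norm_polarCoord_symm_sub_sq (p : ℝ × ℝ) (ρ : ℝ) :
    ‖Complex.polarCoord.symm p - ρ‖ ^ 2 = p.1 ^ 2 + ρ ^ 2 - 2 * p.1 * ρ * Real.cos p.2 := by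
  rw [Complex.polarCoord_symm_apply, ← Complex.normSq_eq_norm_sq, Complex.normSq_apply]
  simp only [Complex.sub_re, Complex.mul_re, Complex.add_re, Complex.ofReal_re, Complex.I_re,
    Complex.mul_im, Complex.add_im, Complex.ofReal_im, Complex.I_im, Complex.sub_im]
  linear_combination (p.1 ^ 2) * Real.sin_sq_add_cos_sq p.2

lemma intervalIntegral_even {f : ℝ → ℝ} (hf : Continuous f) (he : ∀ x, f (-x) = f x) (c : ℝ) :
    ∫ x in (-c)..c, f x = 2 * ∫ x in (0 : ℝ)..c, f x := by
  rw [← intervalIntegral.integral_add_adjacent_intervals (b := 0)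
    (hf.intervalIntegrable _ _) (hf.intervalIntegrable _ _)]
  have : ∫ x in (-c)..0, f x = ∫ x in (0 : ℝ)..c, f x := by
    have := intervalIntegral.integral_comp_neg (a := 0) (b := c) f
    simp only [he, neg_zero] at this
    exact this.symm
  rw [this]
  ring

lemma integral_complex_eq_polar {f : ℂ → ℝ} (hfm : Measurable f) (hf : Integrable f) :
    ∫ z, f z = ∫ r in Set.Ioi (0 : ℝ), ∫ φ in (-Real.pi)..Real.pi,
      r * f (Complex.polarCoord.symm (r, φ)) := by
  have hmeas : MeasurableSet (Set.Ioi (0 : ℝ) ×ˢ Set.Ioo (-Real.pi) Real.pi) :=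
    measurableSet_Ioi.prod measurableSet_Ioo
  -- Fubini needs integrability in polar coordinates; it follows from the change of variables for
  -- the lower integral of `‖f‖ₑ`.
  have hint : IntegrableOn (fun p : ℝ × ℝ => p.1 * f (Complex.polarCoord.symm p))
      (Set.Ioi (0 : ℝ) ×ˢ Set.Ioo (-Real.pi) Real.pi) (volume.prod volume) := by
    refine ⟨?_, ?_⟩
    · have hsymm : Measurable fun p : ℝ × ℝ => Complex.polarCoord.symm p := by
        simp_rw [Complex.polarCoord_symm_apply]
        fun_prop
      exact (measurable_fst.mul (hfm.comp hsymm)).aestronglyMeasurable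
    · rw [hasFiniteIntegral_iff_enorm]
      have := Complex.lintegral_comp_polarCoord_symm fun z => ‖f z‖ₑ
      refine lt_of_eq_of_lt ?_ (this.trans_lt hf.2)
      refine setLIntegral_congr_fun hmeas fun p hp => ?_
      simp only [smul_eq_mul, enorm_mul]
      rw [Real.enorm_of_nonneg (le_of_lt hp.1)]
  rw [← Complex.integral_comp_polarCoord_symm]
  change ∫ p in Set.Ioi (0 : ℝ) ×ˢ Set.Ioo (-Real.pi) Real.pi,
    p.1 * f (Complex.polarCoord.symm p) ∂(volume.prod volume) = _
  rw [setIntegral_prod _ hint]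
  congr 1
  ext r
  rw [intervalIntegral.integral_of_le (by linarith [Real.pi_pos]), integral_Ioc_eq_integral_Ioo]

/-- The integral `Psi` in polar coordinates is an integral over the plane. -/
lemma Psi_eq_laplaceExponent {α : ℝ} (hα : 2 < α) (xr : Plane) {s t : ℝ} (hs : 0 ≤ s)
    (ht : 0 ≤ t) :
    Psi (fun r φ => s * (1 + (r ^ 2 + ‖xr‖ ^ 2 - 2 * r * ‖xr‖ * Real.cos φ) ^ (α / 2))⁻¹)
      (fun r => t * (1 + r ^ α)⁻¹) = laplaceExponent α xr s t := by
  obtain ⟨e, he⟩ := exists_linearIsometryEquiv_complex xr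
  have hint := (e.measurePreserving.integrable_comp_emb
    e.toHomeomorph.measurableEmbedding).2 (integrable_laplaceExponent hα xr hs ht)
  have h1 : laplaceExponent α xr s t = ∫ z : ℂ, (fun x : Plane =>
      1 - 1 / ((1 + s * pathLoss α ‖x - xr‖) * (1 + t * pathLoss α ‖x‖))) (e z) :=
    (e.measurePreserving.integral_comp e.toHomeomorph.measurableEmbedding _).symm
  have hm : Measurable ((fun x : Plane =>
      1 - 1 / ((1 + s * pathLoss α ‖x - xr‖) * (1 + t * pathLoss α ‖x‖))) ∘ e) :=
    Measurable.comp (by fun_prop) e.continuous.measurable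
  refine Eq.trans ?_ (h1.trans (integral_complex_eq_polar hm hint)).symm
  rw [Psi]
  refine setIntegral_congr_fun measurableSet_Ioi fun r hr => ?_
  have hr0 : 0 < r := hr
  -- By the law of cosines this expression is a squared distance.
  have hD : ∀ φ, 0 ≤ r ^ 2 + ‖xr‖ ^ 2 - 2 * r * ‖xr‖ * Real.cos φ := fun φ => by
    have := norm_polarCoord_symm_sub_sq (r, φ) ‖xr‖
    simp only at this
    rw [← this]
    positivity
  have hfun : ∀ φ, r * (fun x : Plane =>
      1 - 1 / ((1 + s * pathLoss α ‖x - xr‖) * (1 + t * pathLoss α ‖x‖)))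
        (e (Complex.polarCoord.symm (r, φ))) =
      r * (1 - 1 / ((1 + s * (1 + (r ^ 2 + ‖xr‖ ^ 2 - 2 * r * ‖xr‖ * Real.cos φ) ^ (α / 2))⁻¹) *
        (1 + t * (1 + r ^ α)⁻¹))) := by
    intro φ
    have hn1 : ‖e (Complex.polarCoord.symm (r, φ))‖ = r := by
      rw [e.norm_map, Complex.norm_polarCoord_symm]
      exact abs_of_pos hr0
    have hn2 : ‖e (Complex.polarCoord.symm (r, φ)) - xr‖ ^ α =
        (r ^ 2 + ‖xr‖ ^ 2 - 2 * r * ‖xr‖ * Real.cos φ) ^ (α / 2) := by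
      conv_lhs => rw [← he]
      rw [← map_sub, e.norm_map]
      have := norm_polarCoord_symm_sub_sq (r, φ) ‖xr‖
      simp only at this
      rw [← this, ← Real.rpow_natCast, ← Real.rpow_mul (norm_nonneg _)]
      congr 1
      push_cast
      ring
    simp only [pathLoss, hn1, hn2]
  simp only [hfun]
  -- The integrand is even in `φ`; folding the interval onto `[0, π]` produces the factor `2` in
  -- `Psi`.
  rw [intervalIntegral_even]
  · rw [← intervalIntegral.integral_const_mul]
    congr 1
    ext φ
    ring
  · have hc : Continuous fun φ => (r ^ 2 + ‖xr‖ ^ 2 - 2 * r * ‖xr‖ * Real.cos φ) ^ (α / 2) :=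
      Continuous.rpow_const (by fun_prop) fun _ => .inr (by linarith)
    have hp : ∀ φ, 0 ≤ (r ^ 2 + ‖xr‖ ^ 2 - 2 * r * ‖xr‖ * Real.cos φ) ^ (α / 2) := fun φ =>
      Real.rpow_nonneg (hD φ) _
    have hc' : Continuous fun φ =>
        (1 + (r ^ 2 + ‖xr‖ ^ 2 - 2 * r * ‖xr‖ * Real.cos φ) ^ (α / 2))⁻¹ :=
      (continuous_const.add hc).inv₀ fun φ => (add_pos_of_pos_of_nonneg one_pos (hp φ)).ne'
    refine continuous_const.mul (continuous_const.sub (continuous_const.div (by fun_prop) ?_))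
    intro φ
    have := hp φ
    positivity
  · intro φ
    rw [Real.cos_neg]

lemma mul_relLoss (α c : ℝ) (a : Plane) (r : ℝ) :
    c * relLoss α a r = c / pathLoss α ‖a‖ * (1 + r ^ α)⁻¹ := by
  rw [relLoss, pathLoss, div_inv_eq_mul]
  ring

lemma mul_relLossSR (α c : ℝ) (xs xr : Plane) (r φ : ℝ) :
    c * relLossSR α xs xr r φ = c / pathLoss α ‖xs - xr‖ *
      (1 + (r ^ 2 + ‖xr‖ ^ 2 - 2 * r * ‖xr‖ * Real.cos φ) ^ (α / 2))⁻¹ := by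
  rw [relLossSR, pathLoss, div_inv_eq_mul]
  ring

lemma Psi_relLossSR_relLoss {α β c : ℝ} (hα : 2 < α) (hβ : 0 ≤ β) (hc : 0 ≤ c)
    (xs xr a : Plane) :
    Psi (fun r φ => β * relLossSR α xs xr r φ) (fun r => c * relLoss α a r) =
      laplaceExponent α xr (β / pathLoss α ‖xs - xr‖) (c / pathLoss α ‖a‖) := by
  simp_rw [mul_relLossSR, mul_relLoss]
  exact Psi_eq_laplaceExponent hα xr
    (div_nonneg hβ (pathLoss_pos α (norm_nonneg _)).le)
    (div_nonneg hc (pathLoss_pos α (norm_nonneg _)).le)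

lemma Psi_relLossSR_zero {α β : ℝ} (hα : 2 < α) (hβ : 0 ≤ β) (xs xr : Plane) :
    Psi (fun r φ => β * relLossSR α xs xr r φ) (fun _ => 0) =
      laplaceExponent α xr (β / pathLoss α ‖xs - xr‖) 0 := by
  simpa using Psi_relLossSR_relLoss hα hβ le_rfl xs xr xr

lemma Psi_zero_relLoss {α c : ℝ} (hα : 2 < α) (hc : 0 ≤ c) (xr a : Plane) :
    Psi (fun _ _ => 0) (fun r => c * relLoss α a r) =
      laplaceExponent α xr 0 (c / pathLoss α ‖a‖) := by
  simpa using Psi_relLossSR_relLoss hα le_rfl hc a xr a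

/-! ### Positivity of the coefficients -/

lemma integral_pos_of_forall_pos {f : Plane → ℝ} (hf : Integrable f) (hpos : ∀ x, 0 < f x) :
    0 < ∫ x, f x := by
  rw [integral_pos_iff_support_of_nonneg (fun x => (hpos x).le) hf]
  have : Function.support f = Set.univ := Set.eq_univ_of_forall fun x => (hpos x).ne'
  rw [this]
  exact Measure.measure_univ_pos.2 (NeZero.ne _)

/-- The integrands combine to `(p / (1 + p)) * (q / (1 + q))`, the chance that a single interferer
at `x` spoils both links. -/
lemma laplaceExponent_add_sub_pos {α : ℝ} (hα : 2 < α) (xr : Plane) {s t : ℝ} (hs : 0 < s)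
    (ht : 0 < t) :
    0 < laplaceExponent α xr 0 t + laplaceExponent α xr s 0 - laplaceExponent α xr s t := by
  have i1 := integrable_laplaceExponent hα xr le_rfl ht.le
  have i2 := integrable_laplaceExponent hα xr hs.le le_rfl
  have i3 := integrable_laplaceExponent hα xr hs.le ht.le
  unfold laplaceExponent
  rw [← integral_add i1 i2, ← integral_sub (by exact i1.add i2) i3]
  refine integral_pos_of_forall_pos (by exact (i1.add i2).sub i3) fun x => ?_
  have hp := mul_pos hs (pathLoss_pos α (norm_nonneg (x - xr)))
  have hq := mul_pos ht (pathLoss_pos α (norm_nonneg x))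
  set p := s * pathLoss α ‖x - xr‖
  set q := t * pathLoss α ‖x‖
  have : 1 - 1 / ((1 + 0 * pathLoss α ‖x - xr‖) * (1 + q)) +
      (1 - 1 / ((1 + p) * (1 + 0 * pathLoss α ‖x‖))) - (1 - 1 / ((1 + p) * (1 + q))) =
      p * q / ((1 + p) * (1 + q)) := by
    simp only [zero_mul, add_zero, one_mul, mul_one]
    field_simp
    ring
  rw [this]
  positivity

/-- In the combined integrand the factor `b - c` cancels, so the sign does not depend on which of
`b` and `c` is larger. -/
lemma laplaceExponent_weighted_pos {α : ℝ} (hα : 2 < α) (xr : Plane) {s b c β : ℝ}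
    (hs : 0 ≤ s) (hb : 0 < b) (hc : 0 < c) (hβ : 0 < β) (hbc : b ≠ c) :
    0 < b / (b - c) * laplaceExponent α xr s (β / b)
      - c / (b - c) * laplaceExponent α xr s (β / c) - laplaceExponent α xr s 0 := by
  have i1 := (integrable_laplaceExponent hα xr hs (by positivity : 0 ≤ β / b)).const_mul
    (b / (b - c))
  have i2 := (integrable_laplaceExponent hα xr hs (by positivity : 0 ≤ β / c)).const_mul
    (c / (b - c))
  have i3 := integrable_laplaceExponent hα xr hs le_rfl
  unfold laplaceExponent
  rw [← integral_const_mul, ← integral_const_mul, ← integral_sub i1 i2,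
    ← integral_sub (by exact i1.sub i2) i3]
  refine integral_pos_of_forall_pos (by exact (i1.sub i2).sub i3) fun x => ?_
  have hp := mul_nonneg hs (pathLoss_pos α (norm_nonneg (x - xr))).le
  have hl := pathLoss_pos α (norm_nonneg x)
  set p := s * pathLoss α ‖x - xr‖
  set l := pathLoss α ‖x‖
  have hbc' : b - c ≠ 0 := sub_ne_zero.2 hbc
  have : b / (b - c) * (1 - 1 / ((1 + p) * (1 + β / b * l)))
      - c / (b - c) * (1 - 1 / ((1 + p) * (1 + β / c * l)))
      - (1 - 1 / ((1 + p) * (1 + 0 * l))) =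
      (β * l) ^ 2 / ((1 + p) * ((b + β * l) * (c + β * l))) := by
    have e1 : 1 + β / b * l = (b + β * l) / b := by field_simp
    have e2 : 1 + β / c * l = (c + β * l) / c := by field_simp
    have : 0 < b + β * l := by positivity
    have : 0 < c + β * l := by positivity
    rw [e1, e2, zero_mul, add_zero, mul_one]
    field_simp
    ring
  rw [this]
  positivity

/-- The confluent case `b = c` of the weighted combination, with `t = β / b`. -/
lemma laplaceExponent_sub_mul_deriv_pos {α : ℝ} (hα : 2 < α) (xr : Plane) {s t : ℝ}
    (hs : 0 ≤ s) (ht : 0 < t) :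
    0 < laplaceExponent α xr s t - laplaceExponent α xr s 0
      - t * deriv (laplaceExponent α xr s) t := by
  obtain ⟨i0, hd⟩ := hasDerivAt_laplaceExponent hα xr hs ht
  have i1 := integrable_laplaceExponent hα xr hs ht.le
  have i2 := integrable_laplaceExponent hα xr hs le_rfl
  have i3 := i0.const_mul t
  rw [hd.deriv]
  unfold laplaceExponent
  rw [← integral_const_mul, ← integral_sub i1 i2, ← integral_sub (by exact i1.sub i2) i3]
  refine integral_pos_of_forall_pos (by exact (i1.sub i2).sub i3) fun x => ?_
  have hp := mul_nonneg hs (pathLoss_pos α (norm_nonneg (x - xr))).le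
  have hl := pathLoss_pos α (norm_nonneg x)
  set p := s * pathLoss α ‖x - xr‖
  set l := pathLoss α ‖x‖
  have : 1 - 1 / ((1 + p) * (1 + t * l)) - (1 - 1 / ((1 + p) * (1 + 0 * l)))
      - t * (l / ((1 + p) * (1 + t * l) ^ 2)) = (t * l) ^ 2 / ((1 + p) * (1 + t * l) ^ 2) := by
    rw [zero_mul, add_zero, mul_one]
    field_simp
    ring
  rw [this]
  positivity

/-! ### Low-density asymptotics -/

lemma tendsto_one_sub_exp_div (a : ℝ) :
    Tendsto (fun lam : ℝ => (1 - Real.exp (-(lam * a))) / lam) (𝓝[>] 0) (𝓝 a) := by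
  have h : HasDerivAt (fun lam : ℝ => 1 - Real.exp (-(lam * a))) a 0 := by
    have := (((hasDerivAt_id (0 : ℝ)).mul_const a).neg.exp).const_sub 1
    simpa using this
  have := h.tendsto_slope_zero_right
  refine this.congr fun lam => ?_
  simp [div_eq_inv_mul]

lemma tendsto_log_div_log_of_tendsto_div {q : ℝ → ℝ} {c : ℝ} (hc : 0 < c)
    (h : Tendsto (fun lam => q lam / lam) (𝓝[>] 0) (𝓝 c)) :
    Tendsto (fun lam => Real.log (q lam) / Real.log lam) (𝓝[>] 0) (𝓝 1) := by
  have h1 : Tendsto (fun lam => Real.log (q lam / lam) / Real.log lam) (𝓝[>] 0) (𝓝 0) :=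
    (h.log hc.ne').div_atBot Real.tendsto_log_nhdsGT_zero
  have h2 := h1.add_const 1
  rw [zero_add] at h2
  refine h2.congr' ?_
  filter_upwards [h.eventually (lt_mem_nhds hc), Ioo_mem_nhdsGT (zero_lt_one (α := ℝ))]
    with lam hq hlam
  have hlog : Real.log lam ≠ 0 := (Real.log_neg hlam.1 hlam.2).ne
  have hq0 : q lam ≠ 0 := fun h0 => by simp [h0] at hq
  rw [Real.log_div hq0 hlam.1.ne']
  field_simp
  ring

theorem theorem1 (α β κ : ℝ) (hα : 2 < α) (hβ : 0 < β) (hκ : 0 < κ) (xs xr : Plane)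
    {Ω : ℝ → Type*} [∀ lam, MeasurableSpace (Ω lam)]
    (P : ∀ lam, Measure (Ω lam)) [∀ lam, IsProbabilityMeasure (P lam)]
    (N : ∀ lam, Network (Ω lam))
    (hN : ∀ lam, 0 < lam → (N lam).IsRayleighPoisson (P lam) lam κ) :
    -- the spatial-contention diversity order equals one
    Tendsto (fun lam => Real.log ((N lam).outage (P lam) α β xs xr) / Real.log lam)
      (𝓝[>] 0) (𝓝 1) ∧
    -- the broadcast-phase outage probability scales linearly
    (0 < coeffBC α β xs xr ∧
      Tendsto (fun lam => (N lam).outageBC (P lam) α β xs xr / lam)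
        (𝓝[>] 0) (𝓝 (coeffBC α β xs xr))) ∧
    -- the MAC-phase outage probability scales linearly
    (∃ c : ℝ, 0 < c ∧
      Tendsto (fun lam => (N lam).outageMAC (P lam) α β xs xr / lam) (𝓝[>] 0) (𝓝 c) ∧
      (‖xs‖ ≠ ‖xr‖ → c = coeffMAC α β xs xr)) := by
  have ha := pathLoss_pos α (norm_nonneg (xs - xr))
  have hb := pathLoss_pos α (norm_nonneg xs)
  have hc := pathLoss_pos α (norm_nonneg xr)
  have hs : 0 < β / pathLoss α ‖xs - xr‖ := by positivity
  have hpos : ∀ᶠ lam : ℝ in 𝓝[>] 0, 0 < lam := self_mem_nhdsWithin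
  have hBCval : coeffBC α β xs xr =
      laplaceExponent α xr 0 (β / (2 * pathLoss α ‖xs‖))
      + laplaceExponent α xr (β / pathLoss α ‖xs - xr‖) 0
      - laplaceExponent α xr (β / pathLoss α ‖xs - xr‖) (β / (2 * pathLoss α ‖xs‖)) := by
    rw [coeffBC, Psi_zero_relLoss hα (by positivity) xr, Psi_relLossSR_zero hα hβ.le,
      Psi_relLossSR_relLoss hα hβ.le (by positivity), div_div]
  have hBC : Tendsto (fun lam => (N lam).outageBC (P lam) α β xs xr / lam)
      (𝓝[>] 0) (𝓝 (coeffBC α β xs xr)) := by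
    rw [hBCval]
    -- The constants are regrouped so that each exponential appears as `1 - exp (-(lam * a))`.
    refine (((tendsto_one_sub_exp_div _).add (tendsto_one_sub_exp_div _)).sub
      (tendsto_one_sub_exp_div _)).congr' ?_
    filter_upwards [hpos] with lam hlam
    rw [(hN lam hlam).outageBC_eq hlam.le hκ hα hβ]
    ring
  have hBCpos : 0 < coeffBC α β xs xr := by
    rw [hBCval]
    exact laplaceExponent_add_sub_pos hα xr hs (by positivity)
  have hMAC : ∃ c : ℝ, 0 < c ∧
      Tendsto (fun lam => (N lam).outageMAC (P lam) α β xs xr / lam) (𝓝[>] 0) (𝓝 c) ∧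
      (‖xs‖ ≠ ‖xr‖ → c = coeffMAC α β xs xr) := by
    by_cases hbc : pathLoss α ‖xs‖ = pathLoss α ‖xr‖
    · refine ⟨_, laplaceExponent_sub_mul_deriv_pos hα xr hs.le
        (by positivity : 0 < β / pathLoss α ‖xs‖), ?_, fun hne => absurd ?_ hne⟩
      · have hexp : Tendsto (fun lam : ℝ => Real.exp (-(lam *
            laplaceExponent α xr (β / pathLoss α ‖xs - xr‖) (β / pathLoss α ‖xs‖))))
            (𝓝[>] 0) (𝓝 1) := by
          have : Continuous fun lam : ℝ => Real.exp (-(lam *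
            laplaceExponent α xr (β / pathLoss α ‖xs - xr‖) (β / pathLoss α ‖xs‖))) := by fun_prop
          simpa using (this.tendsto 0).mono_left nhdsWithin_le_nhds
        -- The derivative term already carries a factor `lam`; after division only its exponential
        -- depends on `lam`, and that tends to `1`.
        have := ((tendsto_one_sub_exp_div (laplaceExponent α xr (β / pathLoss α ‖xs - xr‖)
          (β / pathLoss α ‖xs‖))).sub (tendsto_one_sub_exp_div (laplaceExponent α xr
          (β / pathLoss α ‖xs - xr‖) 0))).sub (hexp.const_mul (β / pathLoss α ‖xs‖ *
            deriv (laplaceExponent α xr (β / pathLoss α ‖xs - xr‖)) (β / pathLoss α ‖xs‖)))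
        rw [mul_one] at this
        refine this.congr' ?_
        filter_upwards [hpos] with lam hlam
        rw [(hN lam hlam).outageMAC_eq_of_eq hlam.le hκ hα hβ xs xr hbc]
        field_simp
        ring
      · have h1 : ‖xs‖ ^ α = ‖xr‖ ^ α := by
          simpa [pathLoss] using hbc
        exact (Real.rpow_left_inj (norm_nonneg _) (norm_nonneg _) (by linarith)).1 h1
    · refine ⟨_, laplaceExponent_weighted_pos hα xr hs.le hb hc hβ hbc, ?_, fun _ => ?_⟩
      -- Since `μ₁ - μ₂ = 1`, the constants cancel and the outage is a combination of terms `1 - exp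
      -- (-(lam * a))` with weights `μ₁`, `-μ₂`, `-1`.
      · refine ((((tendsto_one_sub_exp_div _).const_mul _).sub
          ((tendsto_one_sub_exp_div _).const_mul _)).sub (tendsto_one_sub_exp_div _)).congr' ?_
        filter_upwards [hpos] with lam hlam
        rw [(hN lam hlam).outageMAC_eq_of_ne hlam.le hκ hα hβ xs xr hbc]
        have : pathLoss α ‖xs‖ - pathLoss α ‖xr‖ ≠ 0 := sub_ne_zero.2 hbc
        field_simp
        ring
      · rw [coeffMAC, Psi_relLossSR_zero hα hβ.le, Psi_relLossSR_relLoss hα hβ.le hβ.le,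
          Psi_relLossSR_relLoss hα hβ.le hβ.le]
  refine ⟨?_, ⟨hBCpos, hBC⟩, hMAC⟩
  obtain ⟨c, hc0, hlim, -⟩ := hMAC
  refine tendsto_log_div_log_of_tendsto_div (add_pos hBCpos hc0) ((hBC.add hlim).congr' ?_)
  filter_upwards [hpos] with lam hlam
  rw [(hN lam hlam).outage_eq_add, add_div]
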